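/- \textbf{Setting.} A linear space is a set $M$ with a ternary relation $R$ that holds only of triples of distinct points, is invariant under permutations, and satisfies $R(x,y,z)\wedge R(x,y,w)\wedge z\neq w\Rightarrow R(x,w,z)$; substructures are induced, and the empty structure is allowed. A line of a finite linear space $A$ is a set $\ell\subseteq A$ with $|\ell|\ge 2$ such that any three distinct points of $\ell$ are $R$-related and such that $x,y\in\ell$, $z\in A$, $R(x,y,z)$ imply $z\in\ell$. Put $\delta(A)=|A|-\sum_{\ell}(|\ell|-2)$, the sum being over the lines of $A$, and $\delta(C/B)=\delta(BC)-\delta(B)$. Let $K_0$ be the class of finite linear spaces all of whose substructures $A$ have $\delta(A)\ge 0$, and $\hat K_0$ the class of linear spaces all of whose finite substructures are in $K_0$. For finite $A\subseteq M\in\hat K_0$ write $A\le M$ if $\delta(A)\le\delta(X)$ for all finite $X$ with $A\subseteq X\subseteq M$; for arbitrary $N\subseteq M$ write $N\le M$ if $N\cap X\le X$ for all finite $X\subseteq M$. A strong embedding is an isomorphism onto a strong substructure ($\le$). Let $d_M(X)=\min\{\delta(Y): X\subseteq Y\subseteq M,\ Y\text{ finite}\}$ for finite $X\subseteq M$. A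 subset $S\subseteq M$ is $d$-closed in $M$ if $a\in S$ whenever $d_M(X\cup\{a\})=d_M(X)$ for some finite $X\subseteq S$. For disjoint finite $B$ and $C\neq\emptyset$ with $BC\in K_0$, $C$ is $0$-primitive over $B$ if $B\le BC$, $\delta(C/B)=0$, and there is no $A_0$ with $B\subsetneq A_0\subsetneq BC$ and $B\le A_0\le BC$; $(B,C)$ is a good pair if moreover $C$ is not $0$-primitive over any $B'\subsetneq B$. Let $\boldsymbol\alpha$ be the isomorphism type of the good pair $(\{b_1,b_2\},\{a\})$ with $R(b_1,b_2,a)$. Let $\mathcal U$ be the set of functions $\mu$ that assign to the isomorphism type of each good pair $(B,C)$ an integer $\mu(B,C)$ with $\mu(B,C)\ge\delta(B)$ if $|C|\ge 2$, and $\mu(\boldsymbol\alpha)\ge 1$. For $B\subseteq M$, $\chi_M(B,C)$ is the maximal number of pairwise disjoint copies of $C$ over $B$ in $M$ (subsets $X$ of $M\setminus B$ with $BX$ isomorphic to $BC$ over $B$). Then $K_\mu$ is the class of $M\in K_0$ with $\chi_M(B,C)\le\mu(B,C)$ for all good pairs with $B\subseteq M$; $\hat K_\mu$ is the class of structures all of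 whose finite substructures are in $K_\mu$; and $K^\mu_d$ is the class of $M\in\hat K_\mu$ that are $d$-closed in every $N\in\hat K_\mu$ with $M\le N$. A countable $M\in\hat K_\mu$ is $(K_\mu,\le)$-generic if whenever $A\le M$ and $A\le B\in K_\mu$ ($A$ finite) there is $B'\le M$ isomorphic to $B$ over $A$, and every finite subset of $M$ is contained in a finite $A\le M$ (so $M$ is a union of finite substructures). \textbf{Theorem.} Let $\mu\in\mathcal U$. \begin{enumerate} \item If $D\le F\in\hat K_\mu$ and $D\le E\in K_\mu$, then there are $G\in\hat K_\mu$ and strong embeddings $F\to G$ and $E\to G$ that agree on $D$ (their images may overlap outside the image of $D$). \item If in addition $F\in K^\mu_d$ and $\delta(E)\le d_F(X)$ for some finite $X\subseteq F$ (in particular, taking $X=D$, whenever $\delta(E)=\delta(D)$), then one may take $G=F$: there is a strong embedding of $E$ into $F$ over $D$. \item $(K_\mu,\le)$ has the amalgamation property: if $D,E,F\in K_\mu$ with $D\le E$ and $D\le F$, there are $G\in K_\mu$ and strong embeddings of $E$ and $F$ into $G$ that agree on $D$. \item There is a $(K_\mu,\le)$-generic structure $\mathcal G_\mu\in\hat K_\mu$.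 \end{enumerate} -/

import Mathlib

universe u v w

/-- Linear spaces in the one-sorted vocabulary with a single ternary relation symbol `R`
(collinearity), which holds only of triples of distinct elements and is invariant under
permutations; two distinct points determine a unique line. -/
class CollSpace (M : Type u) where
  R : M → M → M → Prop
  ne₁₂ : ∀ {x y z}, R x y z → x ≠ y
  ne₁₃ : ∀ {x y z}, R x y z → x ≠ z
  ne₂₃ : ∀ {x y z}, R x y z → y ≠ z
  swap : ∀ {x y z}, R x y z → R y x z
  rot : ∀ {x y z}, R x y z → R y z x
  line : ∀ {x y z w}, R x y z → R x y w → z ≠ w → R x w z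

namespace CollSpace

/-- The induced substructure on a subset. -/
instance subtype {M : Type u} [CollSpace M] (p : M → Prop) : CollSpace (Subtype p) where
  R x y z := R x.1 y.1 z.1
  ne₁₂ h e := ne₁₂ h (congrArg Subtype.val e)
  ne₁₃ h e := ne₁₃ h (congrArg Subtype.val e)
  ne₂₃ h e := ne₂₃ h (congrArg Subtype.val e)
  swap h := swap h
  rot h := rot h
  line h h' n := line h h' (fun e => n (Subtype.ext e))

/-- Embeddings of structures: injective maps that preserve and reflect `R`. -/
structure Emb (M : Type u) (N : Type v) [CollSpace M] [CollSpace N] where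
  toFun : M → N
  inj : Function.Injective toFun
  map_R : ∀ x y z, R (toFun x) (toFun y) (toFun z) ↔ R x y z

section Finite

variable {M : Type u} [CollSpace M]

/-- `ℓ` is a line of the finite substructure `A`: a subset of `A` with at least two points, all
of whose points are collinear, and which is `R`-closed in `A`. A pair of points of `A` that
lies in no `R`-triple of `A` is a (trivial) line. -/
def IsLine (A ℓ : Finset M) : Prop :=
  ℓ ⊆ A ∧ 2 ≤ ℓ.card ∧
    (∀ x ∈ ℓ, ∀ y ∈ ℓ, ∀ z ∈ ℓ, x ≠ y → x ≠ z → y ≠ z → R x y z) ∧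
    (∀ x ∈ ℓ, ∀ y ∈ ℓ, ∀ z ∈ A, R x y z → z ∈ ℓ)

open Classical in
/-- The finite set `L(A)` of lines of `A`. -/
noncomputable def lines (A : Finset M) : Finset (Finset M) :=
  A.powerset.filter (IsLine A)

/-- The predimension `δ(A) = |A| - ∑_{ℓ ∈ L(A)} (|ℓ| - 2)` of a finite substructure. -/
noncomputable def delta (A : Finset M) : ℤ :=
  (A.card : ℤ) - ∑ ℓ ∈ lines A, ((ℓ.card : ℤ) - 2)

/-- `A ≤ B` for finite substructures `A`, `B` of an ambient structure. -/
def Le (A B : Finset M) : Prop :=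
  A ⊆ B ∧ ∀ X : Finset M, A ⊆ X → X ⊆ B → delta A ≤ delta X

open Classical in
/-- `C` (disjoint from `B`, nonempty) is a primitive extension of `B`. -/
def IsPrimitive (B C : Finset M) : Prop :=
  Disjoint B C ∧ C.Nonempty ∧ Le B (B ∪ C) ∧
    ¬ ∃ A₀ : Finset M, B ⊂ A₀ ∧ A₀ ⊂ B ∪ C ∧ Le B A₀ ∧ Le A₀ (B ∪ C)

open Classical in
/-- `C` is `0`-primitive over `B`: primitive with `δ(C/B) = 0`. -/
def IsZeroPrimitive (B C : Finset M) : Prop :=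
  IsPrimitive B C ∧ delta (B ∪ C) - delta B = 0

/-- `(B, C)` is a good pair. -/
def IsGood (B C : Finset M) : Prop :=
  IsZeroPrimitive B C ∧ ∀ B' : Finset M, B' ⊂ B → ¬ IsZeroPrimitive B' C

/-- `S ≤ M` for an arbitrary, possibly infinite, substructure `S` of `M`:
`X ∩ S ≤ X` for all finite `X ⊆ M`. For finite `S` this says that `δ(S) ≤ δ(X)` for all
finite `X` with `S ⊆ X ⊆ M`, see `isStrong_coe_iff`. -/
def IsStrong (S : Set M) : Prop :=
  ∀ X A : Finset M, (A : Set M) = (X : Set M) ∩ S → Le A X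

open Classical in
theorem sum_lines {A U : Finset M} (hAU : A ⊆ U) :
    ∑ ℓ ∈ lines A, ((ℓ.card : ℤ) - 2) =
      ∑ L ∈ lines U, (max ((L ∩ A).card : ℤ) 2 - 2) := by
  have h1 : ∑ L ∈ lines U, (max ((L ∩ A).card : ℤ) 2 - 2) =
      ∑ L ∈ (lines U).filter (fun L => 2 ≤ (L ∩ A).card), (((L ∩ A).card : ℤ) - 2) := by
    rw [Finset.sum_filter]
    refine Finset.sum_congr rfl fun L _ => ?_
    split_ifs with h
    · rw [max_eq_left (by exact_mod_cast h)]
    · rw [max_eq_right (by exact_mod_cast (by omega : (L ∩ A).card ≤ 2))]; ring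
  rw [h1]
  symm
  refine Finset.sum_bij (fun L _ => L ∩ A) ?_ ?_ ?_ ?_
  · intro L hL
    simp only [lines, Finset.mem_filter, Finset.mem_powerset] at hL ⊢
    obtain ⟨⟨_, _, _, hc, hcl⟩, h2⟩ := hL
    refine ⟨Finset.inter_subset_right, Finset.inter_subset_right, h2, ?_, ?_⟩
    · intro x hx y hy z hz
      exact hc x (Finset.mem_inter.1 hx).1 y (Finset.mem_inter.1 hy).1 z (Finset.mem_inter.1 hz).1
    · intro x hx y hy z hz hR
      exact Finset.mem_inter.2 ⟨hcl x (Finset.mem_inter.1 hx).1 y (Finset.mem_inter.1 hy).1 z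
        (hAU hz) hR, hz⟩
  · intro L hL L' hL' he
    simp only [lines, Finset.mem_filter, Finset.mem_powerset] at hL hL'
    obtain ⟨⟨_, hs, _, hc, hcl⟩, h2⟩ := hL
    obtain ⟨⟨_, hs', _, hc', hcl'⟩, _⟩ := hL'
    obtain ⟨a, ha, b, hb, hab⟩ := Finset.one_lt_card.1 (by omega : 1 < (L ∩ A).card)
    have ha' := ha
    have hb' := hb
    rw [he] at ha' hb'
    rw [Finset.mem_inter] at ha hb ha' hb'
    ext x
    by_cases hxa : x = a
    · subst hxa; exact ⟨fun _ => ha'.1, fun _ => ha.1⟩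
    by_cases hxb : x = b
    · subst hxb; exact ⟨fun _ => hb'.1, fun _ => hb.1⟩
    constructor
    · intro hx
      exact hcl' a ha'.1 b hb'.1 x (hs hx)
        (hc a ha.1 b hb.1 x hx hab (Ne.symm hxa) (Ne.symm hxb))
    · intro hx
      exact hcl a ha.1 b hb.1 x (hs' hx)
        (hc' a ha'.1 b hb'.1 x hx hab (Ne.symm hxa) (Ne.symm hxb))
  · intro ℓ hℓ
    simp only [lines, Finset.mem_filter, Finset.mem_powerset] at hℓ
    obtain ⟨_, hs, h2, hc, hcl⟩ := hℓ
    obtain ⟨a, ha, b, hb, hab⟩ := Finset.one_lt_card.1 (by omega : 1 < ℓ.card)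
    have key : U.filter (fun x => x = a ∨ x = b ∨ R a b x) ∩ A = ℓ := by
      ext x
      simp only [Finset.mem_inter, Finset.mem_filter]
      constructor
      · rintro ⟨⟨_, rfl | rfl | h⟩, hA⟩
        · exact ha
        · exact hb
        · exact hcl a ha b hb x hA h
      · intro hx
        refine ⟨⟨hAU (hs hx), ?_⟩, hs hx⟩
        by_cases hxa : x = a
        · exact Or.inl hxa
        by_cases hxb : x = b
        · exact Or.inr (Or.inl hxb)
        exact Or.inr (Or.inr (hc a ha b hb x hx hab (Ne.symm hxa) (Ne.symm hxb)))
    refine ⟨U.filter (fun x => x = a ∨ x = b ∨ R a b x), ?_, key⟩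
    have hsub : ℓ ⊆ U.filter (fun x => x = a ∨ x = b ∨ R a b x) := by
      rw [← key]; exact Finset.inter_subset_left
    have tri : ∀ x y z : M, (x = a ∨ x = b ∨ R a b x) → (y = a ∨ y = b ∨ R a b y) →
        (z = a ∨ z = b ∨ R a b z) → x ≠ y → x ≠ z → y ≠ z → R x y z := by
      have two : ∀ y z : M, R a b y → (z = b ∨ R a b z) → y ≠ z → R a y z := by
        rintro y z hy (rfl | hz) hyz
        · exact rot (swap hy)
        · exact line hz hy (Ne.symm hyz)
      have two' : ∀ y z : M, (y = b ∨ R a b y) → (z = b ∨ R a b z) → y ≠ z → R a y z := by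
        rintro y z (rfl | hy) hz hyz
        · rcases hz with rfl | hz
          · exact absurd rfl hyz
          · exact hz
        · exact two y z hy hz hyz
      intro x y z hx hy hz hxy hxz hyz
      rcases hx with rfl | hx
      · exact two' y z (hy.resolve_left (Ne.symm hxy)) (hz.resolve_left (Ne.symm hxz)) hyz
      rcases hy with rfl | hy
      · exact swap (two' x z hx (hz.resolve_left (Ne.symm hyz)) hxz)
      rcases hz with rfl | hz
      · exact rot (two' x y hx hy hxy)
      have hxa : R a x y := two' x y hx hy hxy
      have hxb : R a x z := two' x z hx hz hxz
      exact line (swap hxb) (swap hxa) (Ne.symm hyz)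
    simp only [lines, Finset.mem_filter, Finset.mem_powerset]
    refine ⟨⟨Finset.filter_subset _ _, Finset.filter_subset _ _,
      h2.trans (Finset.card_le_card hsub), ?_, ?_⟩, by rw [key]; exact h2⟩
    · intro x hx y hy z hz
      exact tri x y z (Finset.mem_filter.1 hx).2 (Finset.mem_filter.1 hy).2
        (Finset.mem_filter.1 hz).2
    · intro x hx y hy z hz hR
      refine Finset.mem_filter.2 ⟨hz, ?_⟩
      have hx' := (Finset.mem_filter.1 hx).2
      have hy' := (Finset.mem_filter.1 hy).2
      by_cases hza : z = a
      · exact Or.inl hza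
      by_cases hzb : z = b
      · exact Or.inr (Or.inl hzb)
      refine Or.inr (Or.inr ?_)
      -- one of `x`, `y` differs from `a`; pass from `x y` to `a` and then to `a b`
      have hxy := ne₁₂ hR
      have hax : ∃ t, (t = b ∨ R a b t) ∧ R a t z := by
        by_cases hxa : x = a
        · subst hxa; exact ⟨y, hy'.resolve_left (Ne.symm hxy), hR⟩
        · by_cases hya : y = a
          · subst hya; exact ⟨x, hx'.resolve_left hxa, swap hR⟩
          · refine ⟨x, hx'.resolve_left hxa, ?_⟩
            have h3 : R x y a := tri x y a hx' hy' (Or.inl rfl) hxy hxa hya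
            exact swap (line hR h3 hza)
      obtain ⟨t, ht, htz⟩ := hax
      rcases ht with rfl | ht
      · exact htz
      · have h4 : R a t b := rot (swap ht)
        exact line htz h4 hzb
  · intro L hL
    rfl

open Classical in
theorem delta_submodular (A B : Finset M) :
    delta (A ∪ B) + delta (A ∩ B) ≤ delta A + delta B := by
  unfold delta
  rw [sum_lines (U := A ∪ B) (A := A) Finset.subset_union_left,
    sum_lines (U := A ∪ B) (A := B) Finset.subset_union_right,
    sum_lines (U := A ∪ B) (A := A ∩ B)
      (Finset.inter_subset_left.trans Finset.subset_union_left),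
    sum_lines (U := A ∪ B) (A := A ∪ B) subset_rfl]
  have hcard := Finset.card_union_add_card_inter A B
  have hle : ∑ L ∈ lines (A ∪ B), (max ((L ∩ A).card : ℤ) 2 - 2) +
      ∑ L ∈ lines (A ∪ B), (max ((L ∩ B).card : ℤ) 2 - 2) ≤
      ∑ L ∈ lines (A ∪ B), (max ((L ∩ (A ∪ B)).card : ℤ) 2 - 2) +
      ∑ L ∈ lines (A ∪ B), (max ((L ∩ (A ∩ B)).card : ℤ) 2 - 2) := by
    rw [← Finset.sum_add_distrib, ← Finset.sum_add_distrib]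
    refine Finset.sum_le_sum fun L _ => ?_
    have h := Finset.card_union_add_card_inter (L ∩ A) (L ∩ B)
    rw [← Finset.inter_union_distrib_left, ← Finset.inter_inter_distrib_left] at h
    have h1 : (L ∩ (A ∩ B)).card ≤ (L ∩ A).card :=
      Finset.card_le_card (Finset.inter_subset_inter_left Finset.inter_subset_left)
    have h2 : (L ∩ (A ∩ B)).card ≤ (L ∩ B).card :=
      Finset.card_le_card (Finset.inter_subset_inter_left Finset.inter_subset_right)
    omega
  have : ((A ∪ B).card : ℤ) + (A ∩ B).card = A.card + B.card := by exact_mod_cast hcard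
  linarith

open Classical in
/-- For finite `A`, `A ≤ M` if and only if `δ(A) ≤ δ(X)` whenever `A ⊆ X ⊆ M`, `X` finite. -/
theorem isStrong_coe_iff (A : Finset M) :
    IsStrong (A : Set M) ↔ ∀ X : Finset M, A ⊆ X → delta A ≤ delta X := by
  constructor
  · intro h X hAX
    exact (h X A (by rw [Set.inter_eq_right.2 (Finset.coe_subset.2 hAX)])).2 X hAX subset_rfl
  · intro h X B hB
    have hB' : B = X ∩ A := by
      apply Finset.coe_injective
      rw [hB, Finset.coe_inter]
    subst hB'
    refine ⟨Finset.inter_subset_left, fun Y hY hYX => ?_⟩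
    have hAY : A ∩ Y = X ∩ A := by
      ext x
      simp only [Finset.mem_inter]
      exact ⟨fun h => ⟨hYX h.2, h.1⟩, fun h => ⟨h.2, hY (Finset.mem_inter.2 h)⟩⟩
    have h1 := delta_submodular A Y
    have h2 := h (A ∪ Y) Finset.subset_union_left
    rw [hAY] at h1
    linarith

end Finite

/-- `M` belongs to `K̂₀`: every finite substructure has nonnegative predimension.
The class `K₀` consists of the finite members of `K̂₀`. -/
def InKHat0 (M : Type u) [CollSpace M] : Prop :=
  ∀ A : Finset M, 0 ≤ delta A

/-- `M` belongs to `K₀`. -/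
def InK0 (M : Type u) [CollSpace M] : Prop :=
  Finite M ∧ InKHat0 M

/-- A good pair `(B, C)`, given as a structure `BC` in `K₀` with distinguished subset `B`. -/
structure GoodPair where
  carrier : Type
  [space : CollSpace carrier]
  [fin : Fintype carrier]
  [dec : DecidableEq carrier]
  inK0 : InK0 carrier
  base : Finset carrier
  good : IsGood base baseᶜ

attribute [instance] GoodPair.space GoodPair.fin GoodPair.dec

namespace GoodPair

/-- Isomorphism of good pairs: an isomorphism `BC ≅ B'C'` that maps `B` onto `B'`. -/
def Iso (P Q : GoodPair) : Prop :=
  ∃ e : P.carrier ≃ Q.carrier,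
    (∀ x y z, R (e x) (e y) (e z) ↔ R x y z) ∧ ∀ x, e x ∈ Q.base ↔ x ∈ P.base

/-- The isomorphism type of `({b₁, b₂}, a)` with `R(b₁, b₂, a)`. -/
def IsAlpha (P : GoodPair) : Prop :=
  ∃ b₁ b₂ a : P.carrier, R b₁ b₂ a ∧ P.base = {b₁, b₂} ∧ ∀ x, x = b₁ ∨ x = b₂ ∨ x = a

end GoodPair

/-- The collection `𝒰`: functions of the isomorphism type of a good pair `(B, C)`, with
`μ(B, C) ≥ δ(B)` if `C` has at least two elements, and `μ(α) ≥ 1`. -/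
structure InU (μ : GoodPair → ℕ) : Prop where
  iso : ∀ P Q : GoodPair, P.Iso Q → μ P = μ Q
  base_le : ∀ P : GoodPair, 2 ≤ P.baseᶜ.card → delta P.base ≤ (μ P : ℤ)
  alpha : ∀ P : GoodPair, P.IsAlpha → 1 ≤ μ P

section Classes

variable {M : Type u} [CollSpace M]

/-- For a good pair `P = (B, C)` and a copy `e` of `B` in `M`: `X ⊆ M` is a copy of `C` over `B`,
that is, there is an isomorphism from `BC` onto `e(B) ∪ X` that extends `e` and maps
`C` onto `X`. -/
def IsCopy (P : GoodPair) (e : Emb P.base M) (X : Finset M) : Prop :=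
  ∃ f : Emb P.carrier M, (∀ b : P.base, f.toFun b.1 = e.toFun b) ∧
    (X : Set M) = f.toFun '' {c | c ∉ P.base}

/-- `χ_M(B, C)`: the maximal number of pairwise disjoint copies of `C` over `B` in `M`. -/
noncomputable def chi (P : GoodPair) (e : Emb P.base M) : ℕ∞ :=
  ⨆ 𝒞 : {𝒞 : Finset (Finset M) //
      (∀ X ∈ 𝒞, IsCopy P e X) ∧ (𝒞 : Set (Finset M)).PairwiseDisjoint id},
    (𝒞.1.card : ℕ∞)

/-- `d_M(X) = min {δ(Y) : X ⊆ Y ⊆ M, Y finite}`, for `M` in `K̂₀`. -/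
noncomputable def dimM (X : Finset M) : ℤ :=
  sInf {k : ℤ | ∃ Y : Finset M, X ⊆ Y ∧ delta Y = k}

open Classical in
/-- `S` is `d`-closed in `M`: if `d_M(aX) = d_M(X)` for some finite `X ⊆ S`, then `a ∈ S`. -/
def DClosed (S : Set M) : Prop :=
  ∀ (a : M) (X : Finset M), (X : Set M) ⊆ S → dimM (insert a X) = dimM X → a ∈ S

end Classes

/-- `M` belongs to `K_μ`. -/
def InKmu (μ : GoodPair → ℕ) (M : Type u) [CollSpace M] : Prop :=
  InK0 M ∧ ∀ (P : GoodPair) (e : Emb P.base M), chi P e ≤ (μ P : ℕ∞)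

/-- `M` belongs to `K̂_μ`: all finite substructures of `M` belong to `K_μ`. -/
def InKmuHat (μ : GoodPair → ℕ) (M : Type u) [CollSpace M] : Prop :=
  ∀ A : Finset M, InKmu μ A

/-- A strong embedding: an isomorphism onto a strong substructure. -/
structure StrongEmb (M : Type u) (N : Type v) [CollSpace M] [CollSpace N] extends Emb M N where
  strong : IsStrong (Set.range toFun)

/-- `M` belongs to `K^μ_d`: `M ∈ K̂_μ`, and `M` is `d`-closed in every `N ∈ K̂_μ` with
`M ≤ N`. -/
def InKmud (μ : GoodPair → ℕ) (M : Type u) [CollSpace M] : Prop :=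
  InKmuHat μ M ∧ ∀ (N : Type u) [CollSpace N], InKmuHat μ N →
    ∀ i : StrongEmb M N, DClosed (Set.range i.toFun)

/-- The amalgamation property of `(K_μ, ≤)`. -/
def AmalgamationProperty (μ : GoodPair → ℕ) : Prop :=
  ∀ (D E F : Type u) [CollSpace D] [CollSpace E] [CollSpace F],
    InKmu μ D → InKmu μ E → InKmu μ F →
    ∀ (f : StrongEmb D F) (g : StrongEmb D E),
      ∃ (G : Type u) (_ : CollSpace G) (f' : StrongEmb F G) (g' : StrongEmb E G),
        InKmu μ G ∧ ∀ x, f'.toFun (f.toFun x) = g'.toFun (g.toFun x)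

/-- `M` is `(K_μ, ≤)`-generic: a countable member of `K̂_μ`, such that if `A ≤ M` and
`A ≤ B ∈ K_μ`, then there is `B' ≤ M` isomorphic to `B` over `A`; and `M` is a union of finite
(even strong) substructures. -/
structure IsGeneric (μ : GoodPair → ℕ) (M : Type u) [CollSpace M] : Prop where
  countable : Countable M
  inKmuHat : InKmuHat μ M
  extend : ∀ (A B : Type u) [CollSpace A] [CollSpace B], InKmu μ A → InKmu μ B →
    ∀ (f : StrongEmb A M) (g : StrongEmb A B),
      ∃ h : StrongEmb B M, ∀ x, h.toFun (g.toFun x) = f.toFun x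
  union : ∀ X : Finset M, ∃ A : Finset M, X ⊆ A ∧ IsStrong (A : Set M)

end CollSpace

/-!
All four assertions follow from amalgamating one primitive extension at a time: a strong extension
`D ≤ E` of finite structures is a chain of strong extensions with no strong substructure strictly
in between (`primitive_induction`).

Let `E` be primitive over `D ≤ F`. If `E` and `F` both add a point to the same line of `D`, then
`E` consists of `D` and that one point, and it embeds into `F` over `D`
(`PrimitiveEmb.exists_strongEmb_of_conflict`). Otherwise the union of the two relations is a linear
space `G` on `F ∪_D E` (`exists_glue`), in which every collinear triple lies in `F` or in `E`; the
predimension is modular for such a free union (`delta_free`), so `F` and `E` are strong in `G`. The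
core of the argument is `FreeAmalgam.boundedIn_or_exists_copy`: if `G` is not in `K̂_μ`, then `F`
already contains a copy of `E` over `D`. Take more than `μ(B, C)` pairwise disjoint copies of `C`
over `B` in `G`.

* If `B ⊆ F`, each copy lies in `F` or avoids it. One avoids it and therefore equals `E ∖ D`, so
  `B ⊆ D`. Since `E` satisfies the bound, another copy lies in `F` outside `D`, and it has no
  collinearities with `D` except those with `B` (`IsGood.mem_of_R`); this is a copy of `E`
  over `D`. (Copies with a single point are excluded: the line of `B` would cross from `E ∖ D` to
  `F ∖ D`.)
* If `B ⊆ E` and `B ⊄ F`, some copy avoids `E`, but points of `B ∖ F` are collinear with it.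
* If `B` lies in neither side, the copies have at least two points, and as `δ(B) ≤ μ(B, C)` in
  that case, it suffices to bound their number by `δ(B)`
  (`FreeAmalgam.card_le_of_base_crosses`). A copy split by a strong substructure costs one unit of
  predimension, so the bound holds if `F` or `E` splits all copies. Otherwise `E` is
  `D` with one point added to a line of `D`, all copies lie in `D`, and all of them meet the line of
  a point of `B ∖ F` and the line of a point of `B ∖ E`; each copy after the first then lowers the
  predimension by two (`FreeAmalgam.delta_union_two_lines`).

The numerical input throughout is a sharpening of submodularity that counts the lines crossing
between two sets (`delta_add_card_le`).

If `F ∈ K^μ_d` and `δ(E) = δ(D)`, every point of `E` in an amalgam `G ∈ K̂_μ` lies in the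
`d`-closure of `F`, hence in `F`, so `E` embeds into `F`. If `δ(E) > δ(D)`, then
`E` is `D` with one independent point, and the lower bound on the dimension of `F` provides such a
point in `F`. The generic structure is the union of a chain of finite members of `K_μ` in which each
step solves the finitely many extension problems of bounded size over the previous member
(`exists_solve`, `exists_generic`).
-/

namespace CollSpace

section Predimension

open Classical

variable {M : Type u} [CollSpace M]

/-! ### Lines and the predimension -/

/-- `x` lies on the line through `a` and `b`. -/
def Col (a b x : M) : Prop := x = a ∨ x = b ∨ R a b x

theorem R_of_col {a b x y z : M} (hx : Col a b x) (hy : Col a b y) (hz : Col a b z)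
    (hxy : x ≠ y) (hxz : x ≠ z) (hyz : y ≠ z) : R x y z := by
  have two : ∀ y z : M, (y = b ∨ R a b y) → (z = b ∨ R a b z) → y ≠ z → R a y z := by
    rintro y z (rfl | hy) hz hyz
    · exact hz.resolve_left (Ne.symm hyz)
    · rcases hz with rfl | hz
      · exact rot (swap hy)
      · exact line hz hy (Ne.symm hyz)
  rcases hx with rfl | hx
  · exact two y z (hy.resolve_left (Ne.symm hxy)) (hz.resolve_left (Ne.symm hxz)) hyz
  rcases hy with rfl | hy
  · exact swap (two x z hx (hz.resolve_left (Ne.symm hyz)) hxz)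
  rcases hz with rfl | hz
  · exact rot (two x y hx hy hxy)
  exact line (swap (two x z hx hz hxz)) (swap (two x y hx hy hxy)) (Ne.symm hyz)

theorem col_of_R {a b x y z : M} (hab : a ≠ b) (hx : Col a b x) (hy : Col a b y)
    (hR : R x y z) : Col a b z := by
  have hxy := ne₁₂ hR
  by_cases hza : z = a
  · exact Or.inl hza
  by_cases hzb : z = b
  · exact Or.inr (Or.inl hzb)
  refine Or.inr (Or.inr ?_)
  have hax : ∃ t, (t = b ∨ R a b t) ∧ R a t z := by
    by_cases hxa : x = a
    · subst hxa; exact ⟨y, hy.resolve_left (Ne.symm hxy), hR⟩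
    · by_cases hya : y = a
      · subst hya; exact ⟨x, hx.resolve_left hxa, swap hR⟩
      · refine ⟨x, hx.resolve_left hxa, ?_⟩
        exact swap (line hR (R_of_col hx hy (Or.inl rfl) hxy hxa hya) hza)
  obtain ⟨t, ht, htz⟩ := hax
  rcases ht with rfl | ht
  · exact htz
  · exact line htz (rot (swap ht)) hzb

theorem mem_lines {U L : Finset M} : L ∈ lines U ↔ IsLine U L := by
  simp only [lines, Finset.mem_filter, Finset.mem_powerset]
  exact ⟨fun h => h.2, fun h => ⟨h.1, h⟩⟩

theorem exists_line {U : Finset M} {a b : M} (ha : a ∈ U) (hb : b ∈ U) (hab : a ≠ b) :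
    ∃ L ∈ lines U, a ∈ L ∧ b ∈ L := by
  have haL : a ∈ U.filter (Col a b) := Finset.mem_filter.2 ⟨ha, Or.inl rfl⟩
  have hbL : b ∈ U.filter (Col a b) := Finset.mem_filter.2 ⟨hb, Or.inr (Or.inl rfl)⟩
  refine ⟨U.filter (Col a b), mem_lines.2 ⟨Finset.filter_subset _ _,
    Finset.one_lt_card.2 ⟨a, haL, b, hbL, hab⟩, ?_, ?_⟩, haL, hbL⟩
  · intro x hx y hy z hz
    exact R_of_col (Finset.mem_filter.1 hx).2 (Finset.mem_filter.1 hy).2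
      (Finset.mem_filter.1 hz).2
  · intro x hx y hy z hz hR
    exact Finset.mem_filter.2 ⟨hz, col_of_R hab (Finset.mem_filter.1 hx).2
      (Finset.mem_filter.1 hy).2 hR⟩

theorem exists_line_of_R {U : Finset M} {x y z : M} (h : R x y z) (hx : x ∈ U) (hy : y ∈ U)
    (hz : z ∈ U) : ∃ L ∈ lines U, x ∈ L ∧ y ∈ L ∧ z ∈ L ∧ 3 ≤ L.card := by
  obtain ⟨L, hL, hxL, hyL⟩ := exists_line hx hy (ne₁₂ h)
  have hzL := (mem_lines.1 hL).2.2.2 x hxL y hyL z hz h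
  exact ⟨L, hL, hxL, hyL, hzL,
    Finset.two_lt_card.2 ⟨x, hxL, y, hyL, z, hzL, ne₁₂ h, ne₁₃ h, ne₂₃ h⟩⟩

/-- The difference of the two sides of submodularity, as a sum over the lines of `A ∪ B`. -/
theorem delta_defect (A B : Finset M) :
    delta A + delta B - delta (A ∪ B) - delta (A ∩ B) =
      ∑ L ∈ lines (A ∪ B), (max (L.card : ℤ) 2 + max ((L ∩ (A ∩ B)).card : ℤ) 2 -
        max ((L ∩ A).card : ℤ) 2 - max ((L ∩ B).card : ℤ) 2) := by
  have hcard : ((A ∪ B).card : ℤ) + (A ∩ B).card = A.card + B.card := by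
    exact_mod_cast Finset.card_union_add_card_inter A B
  have h0 : ∑ L ∈ lines (A ∪ B), (max (L.card : ℤ) 2 - 2) =
      ∑ L ∈ lines (A ∪ B), (max ((L ∩ (A ∪ B)).card : ℤ) 2 - 2) :=
    Finset.sum_congr rfl fun L hL => by
      rw [Finset.inter_eq_left.2 (mem_lines.1 hL).1]
  have h1 : ∑ L ∈ lines (A ∪ B), (max (L.card : ℤ) 2 + max ((L ∩ (A ∩ B)).card : ℤ) 2 -
        max ((L ∩ A).card : ℤ) 2 - max ((L ∩ B).card : ℤ) 2) =
      ∑ L ∈ lines (A ∪ B), (max (L.card : ℤ) 2 - 2)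
      + ∑ L ∈ lines (A ∪ B), (max ((L ∩ (A ∩ B)).card : ℤ) 2 - 2)
      - ∑ L ∈ lines (A ∪ B), (max ((L ∩ A).card : ℤ) 2 - 2)
      - ∑ L ∈ lines (A ∪ B), (max ((L ∩ B).card : ℤ) 2 - 2) := by
    rw [← Finset.sum_add_distrib, ← Finset.sum_sub_distrib, ← Finset.sum_sub_distrib]
    exact Finset.sum_congr rfl fun L _ => by ring
  rw [h1, h0]
  unfold delta
  rw [sum_lines (U := A ∪ B) (A := A) Finset.subset_union_left,
    sum_lines (U := A ∪ B) (A := B) Finset.subset_union_right,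
    sum_lines (U := A ∪ B) (A := A ∩ B)
      (Finset.inter_subset_left.trans Finset.subset_union_left),
    sum_lines (U := A ∪ B) (A := A ∪ B) subset_rfl]
  linarith

theorem card_line_parts {α : Type u} {A B L : Finset α} (hL : L ⊆ A ∪ B) :
    L.card + (L ∩ (A ∩ B)).card = (L ∩ A).card + (L ∩ B).card := by
  have h := Finset.card_union_add_card_inter (L ∩ A) (L ∩ B)
  rwa [← Finset.inter_union_distrib_left, ← Finset.inter_inter_distrib_left,
    Finset.inter_eq_left.2 hL] at h

/-- If no collinear triple of `A ∪ B` crosses between `A` and `B`, the predimension is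
modular on `A` and `B`. -/
theorem delta_free {A B : Finset M}
    (h : ∀ x ∈ A ∪ B, ∀ y ∈ A ∪ B, ∀ z ∈ A ∪ B, R x y z →
      (x ∈ A ∧ y ∈ A ∧ z ∈ A) ∨ (x ∈ B ∧ y ∈ B ∧ z ∈ B)) :
    delta (A ∪ B) + delta (A ∩ B) = delta A + delta B := by
  have hz : ∑ L ∈ lines (A ∪ B), (max (L.card : ℤ) 2 + max ((L ∩ (A ∩ B)).card : ℤ) 2 -
      max ((L ∩ A).card : ℤ) 2 - max ((L ∩ B).card : ℤ) 2) = 0 := by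
    refine Finset.sum_eq_zero fun L hL => ?_
    have hL' := mem_lines.1 hL
    have hparts := card_line_parts hL'.1
    have ha : (L ∩ A).card ≤ L.card := Finset.card_le_card Finset.inter_subset_left
    have hb : (L ∩ B).card ≤ L.card := Finset.card_le_card Finset.inter_subset_left
    by_cases h3 : L.card ≤ 2
    · omega
    have hsub : L ⊆ A ∨ L ⊆ B := by
      by_contra hcon
      push Not at hcon
      obtain ⟨p, hp, hpA⟩ := Finset.not_subset.1 hcon.1
      obtain ⟨q, hq, hqB⟩ := Finset.not_subset.1 hcon.2
      have hqA : q ∈ A := (Finset.mem_union.1 (hL'.1 hq)).resolve_right hqB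
      have hpq : p ≠ q := fun e => hpA (e ▸ hqA)
      have hex : ∃ r ∈ L, r ≠ p ∧ r ≠ q := by
        by_contra hno
        push Not at hno
        have : L ⊆ {p, q} := fun r hr => by
          by_cases hrp : r = p
          · simp [hrp]
          · simp [hno r hr hrp]
        exact h3 ((Finset.card_le_card this).trans Finset.card_le_two)
      obtain ⟨r, hr, hrp, hrq⟩ := hex
      rcases h p (hL'.1 hp) q (hL'.1 hq) r (hL'.1 hr)
        (hL'.2.2.1 p hp q hq r hr hpq hrp.symm hrq.symm) with h' | h'
      · exact hpA h'.1
      · exact hqB h'.2.1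
    rcases hsub with hs | hs
    · rw [Finset.inter_eq_left.2 hs] at hparts ⊢
      omega
    · rw [Finset.inter_eq_left.2 hs] at hparts ⊢
      omega
  have := delta_defect A B
  rw [hz] at this
  linarith

/-- Every line of `A ∪ B` that has at least three points, points outside `A` and outside `B`,
and at most one point in `A ∩ B` costs one unit in the submodular inequality. -/
theorem delta_add_card_le {A B : Finset M} (T : Finset (Finset M))
    (hT : ∀ L ∈ T, L ∈ lines (A ∪ B) ∧ (∃ p ∈ L, p ∉ A) ∧ (∃ q ∈ L, q ∉ B) ∧ 3 ≤ L.card ∧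
      (L ∩ (A ∩ B)).card ≤ 1) :
    delta (A ∪ B) + delta (A ∩ B) + T.card ≤ delta A + delta B := by
  have hd := delta_defect A B
  have hnn : ∀ L ∈ lines (A ∪ B), 0 ≤ (max (L.card : ℤ) 2 + max ((L ∩ (A ∩ B)).card : ℤ) 2 -
      max ((L ∩ A).card : ℤ) 2 - max ((L ∩ B).card : ℤ) 2) := by
    intro L hL
    have hparts := card_line_parts (mem_lines.1 hL).1
    have ha : (L ∩ A).card ≤ L.card := Finset.card_le_card Finset.inter_subset_left
    have hb : (L ∩ B).card ≤ L.card := Finset.card_le_card Finset.inter_subset_left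
    omega
  have hle : (T.card : ℤ) ≤ ∑ L ∈ T, (max (L.card : ℤ) 2 + max ((L ∩ (A ∩ B)).card : ℤ) 2 -
      max ((L ∩ A).card : ℤ) 2 - max ((L ∩ B).card : ℤ) 2) := by
    rw [Finset.card_eq_sum_ones, Nat.cast_sum]
    refine Finset.sum_le_sum fun L hL => ?_
    obtain ⟨hL, ⟨p, hp, hpA⟩, ⟨q, hq, hqB⟩, h3, h1⟩ := hT L hL
    have hparts := card_line_parts (mem_lines.1 hL).1
    have ha : (L ∩ A).card < L.card := Finset.card_lt_card
      ⟨Finset.inter_subset_left, fun h => hpA (Finset.mem_inter.1 (h hp)).2⟩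
    have hb : (L ∩ B).card < L.card := Finset.card_lt_card
      ⟨Finset.inter_subset_left, fun h => hqB (Finset.mem_inter.1 (h hq)).2⟩
    push_cast
    omega
  have := Finset.sum_le_sum_of_subset_of_nonneg (fun L hL => (hT L hL).1)
    (fun L hL _ => hnn L hL) (s := T) (t := lines (A ∪ B))
  linarith

theorem lines_eq_empty {A : Finset M} (h : A.card ≤ 1) : lines A = ∅ := by
  refine Finset.eq_empty_of_forall_notMem fun L hL => ?_
  have hL := mem_lines.1 hL
  have := Finset.card_le_card hL.1
  have := hL.2.1
  omega

@[simp] theorem delta_empty : delta (∅ : Finset M) = 0 := by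
  rw [delta, lines_eq_empty (by simp)]
  simp

@[simp] theorem delta_singleton (a : M) : delta ({a} : Finset M) = 1 := by
  rw [delta, lines_eq_empty (by simp)]
  simp

theorem delta_insert_le (a : M) (S : Finset M) (ha : a ∉ S) :
    delta (insert a S) ≤ delta S + 1 := by
  have := delta_submodular S {a}
  rw [Finset.union_comm, Finset.inter_singleton_of_notMem ha, ← Finset.insert_eq] at this
  simpa using this

/-- A point on a line of `S` does not raise the predimension of `S`. -/
theorem delta_insert_le_of_R {S : Finset M} {a x y : M} (ha : a ∉ S) (hx : x ∈ S) (hy : y ∈ S)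
    (h : R a x y) : delta (insert a S) ≤ delta S := by
  have hi : S ∩ {a} = ∅ := Finset.inter_singleton_of_notMem ha
  obtain ⟨L, hL, haL, hxL, hyL, h3⟩ := exists_line_of_R (U := S ∪ {a}) h (by simp)
    (by simp [hx]) (by simp [hy])
  have := delta_add_card_le (A := S) (B := {a}) {L} (by
    intro L' hL'
    rw [Finset.mem_singleton] at hL'
    subst hL'
    exact ⟨hL, ⟨a, haL, ha⟩, ⟨x, hxL, by simpa using (ne₁₂ h).symm⟩, h3, by simp [hi]⟩)
  rw [hi, Finset.union_comm, ← Finset.insert_eq] at this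
  simp at this
  linarith

/-- A point on two distinct lines of `S` lowers the predimension of `S`. -/
theorem R_of_delta_le_insert {S : Finset M} {a x y x' y' : M} (ha : a ∉ S) (hx : x ∈ S)
    (hy : y ∈ S) (hx' : x' ∈ S) (hy' : y' ∈ S) (h : R a x y) (h' : R a x' y')
    (hδ : delta S ≤ delta (insert a S)) (hne : x ≠ x') : R a x x' := by
  by_contra hcon
  have hi : S ∩ {a} = ∅ := Finset.inter_singleton_of_notMem ha
  obtain ⟨L, hL, haL, hxL, hyL, h3⟩ := exists_line_of_R (U := S ∪ {a}) h (by simp)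
    (by simp [hx]) (by simp [hy])
  obtain ⟨L', hL', haL', hxL', hyL', h3'⟩ := exists_line_of_R (U := S ∪ {a}) h' (by simp)
    (by simp [hx']) (by simp [hy'])
  have hLL : L ≠ L' := by
    rintro rfl
    exact hcon ((mem_lines.1 hL).2.2.1 a haL x hxL x' hxL' (ne₁₂ h) (ne₁₂ h') hne)
  have := delta_add_card_le (A := S) (B := {a}) {L, L'} (by
    intro K hK
    rw [Finset.mem_insert, Finset.mem_singleton] at hK
    rcases hK with rfl | rfl
    · exact ⟨hL, ⟨a, haL, ha⟩, ⟨x, hxL, by simpa using (ne₁₂ h).symm⟩, h3, by simp [hi]⟩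
    · exact ⟨hL', ⟨a, haL', ha⟩, ⟨x', hxL', by simpa using (ne₁₂ h').symm⟩, h3', by simp [hi]⟩)
  rw [hi, Finset.union_comm, ← Finset.insert_eq, Finset.card_pair hLL] at this
  simp at this
  linarith

/-- If a point off `S` lies on the line of `S` through `p` and `q` and does not lower the
predimension of `S`, its collinearities with `S` are determined by `p` and `q`. -/
theorem R_iff_col {S : Finset M} {a p q : M} (ha : a ∉ S) (hp : p ∈ S) (hq : q ∈ S)
    (h : R a p q) (hδ : delta S ≤ delta (insert a S)) {x y : M} (hx : x ∈ S) (hy : y ∈ S) :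
    R a x y ↔ x ≠ y ∧ Col p q x ∧ Col p q y := by
  have hpq := ne₂₃ h
  have haC : Col p q a := Or.inr (Or.inr (rot h))
  constructor
  · intro h'
    have key : ∀ x ∈ S, ∀ y ∈ S, R a x y → Col p q x := by
      intro x hx y hy h'
      by_cases hpx : p = x
      · exact Or.inl hpx.symm
      · exact col_of_R hpq haC (Or.inl rfl) (R_of_delta_le_insert ha hp hq hx hy h h' hδ hpx)
    exact ⟨ne₂₃ h', key x hx y hy h', key y hy x hx (swap (rot (rot h')))⟩
  · rintro ⟨hne, hcx, hcy⟩
    exact R_of_col haC hcx hcy (fun e => ha (e ▸ hx)) (fun e => ha (e ▸ hy)) hne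

/-- Adding points that each lie on a line of `S` does not raise the predimension. -/
theorem delta_union_le_of_R {S T : Finset M} (h : ∀ b ∈ T, b ∉ S → ∃ x ∈ S, ∃ y ∈ S, R b x y) :
    delta (S ∪ T) ≤ delta S := by
  induction T using Finset.induction_on with
  | empty => simp
  | insert b T hb ih =>
    have ih' := ih fun b hb hbS => h b (Finset.mem_insert_of_mem hb) hbS
    rw [Finset.union_insert]
    by_cases hbS : b ∈ S ∪ T
    · rwa [Finset.insert_eq_of_mem hbS]
    · obtain ⟨x, hx, y, hy, hR⟩ := h b (Finset.mem_insert_self _ _)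
        fun h' => hbS (Finset.mem_union_left _ h')
      exact (delta_insert_le_of_R hbS (Finset.mem_union_left _ hx) (Finset.mem_union_left _ hy)
        hR).trans ih'

theorem delta_insert_of_not_R {S : Finset M} {a : M} (ha : a ∉ S)
    (h : ∀ x ∈ S, ∀ y ∈ S, ¬ R a x y) : delta (insert a S) = delta S + 1 := by
  have hf := delta_free (A := S) (B := {a}) (by
    intro x hx y hy z hz hR
    left
    simp only [Finset.mem_union, Finset.mem_singleton] at hx hy hz
    have := ne₁₂ hR
    have := ne₁₃ hR
    have := ne₂₃ hR
    rcases hx with hx | rfl <;> rcases hy with hy | rfl <;> rcases hz with hz | rfl <;>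
      try contradiction
    · exact ⟨hx, hy, hz⟩
    · exact absurd (rot (rot hR)) (h _ hx _ hy)
    · exact absurd (rot hR) (h _ hz _ hx)
    · exact absurd hR (h _ hy _ hz))
  rw [Finset.inter_singleton_of_notMem ha, Finset.union_comm, ← Finset.insert_eq] at hf
  simpa using hf

/-! ### Good pairs -/

theorem IsGood.disjoint {B C : Finset M} (h : IsGood B C) : Disjoint B C := h.1.1.1

theorem IsGood.nonempty {B C : Finset M} (h : IsGood B C) : C.Nonempty := h.1.1.2.1

theorem IsGood.delta_eq {B C : Finset M} (h : IsGood B C) : delta (B ∪ C) = delta B := by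
  linarith [h.1.2]

/-- A set between `B` and `B ∪ C` of predimension at most `δ(B)` is strong, hence trivial. -/
theorem IsZeroPrimitive.eq_of_delta_le {B C : Finset M} (h : IsZeroPrimitive B C) {X : Finset M}
    (hBX : B ⊆ X) (hX : X ⊆ B ∪ C) (hδ : delta X ≤ delta B) : X = B ∨ X = B ∪ C := by
  by_contra hcon
  push Not at hcon
  obtain ⟨⟨_, _, hle, hno⟩, h0⟩ := h
  refine hno ⟨X, hBX.ssubset_of_ne hcon.1.symm, hX.ssubset_of_ne hcon.2,
    ⟨hBX, fun Y hY hYX => hle.2 Y hY (hYX.trans hX)⟩, ⟨hX, fun Y hY hYX => ?_⟩⟩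
  exact hδ.trans (hle.2 Y (hBX.trans hY) hYX)

/-- Over the base of a good pair, proper nonempty subsets of `C` raise the predimension. -/
theorem IsGood.lt_of_proper {B C X : Finset M} (h : IsGood B C) (hX : X.Nonempty) (hXC : X ⊂ C) :
    delta B + 1 ≤ delta (B ∪ X) := by
  by_contra hcon
  have hd := h.disjoint
  rcases h.1.eq_of_delta_le Finset.subset_union_left
    (Finset.union_subset_union_right hXC.1) (by linarith : delta (B ∪ X) ≤ delta B) with h' | h'
  · obtain ⟨x, hx⟩ := hX
    have : x ∈ B := h' ▸ Finset.mem_union_right _ hx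
    exact Finset.disjoint_left.1 hd this (hXC.1 hx)
  · obtain ⟨y, hy, hyX⟩ := Finset.exists_of_ssubset hXC
    have : y ∈ B ∪ X := h' ▸ Finset.mem_union_right _ hy
    rcases Finset.mem_union.1 this with h'' | h''
    · exact Finset.disjoint_left.1 hd h'' hy
    · exact hyX h''

/-- Minimality of the base of a good pair: over a smaller base the predimension goes up. -/
theorem IsGood.lt_of_base {B C B' : Finset M} (h : IsGood B C) (hB : B' ⊂ B) :
    delta B' + 1 ≤ delta (B' ∪ C) := by
  by_contra hcon
  have hd := h.disjoint
  have hsub : ∀ X ⊆ C, delta (B ∪ X) + delta B' ≤ delta B + delta (B' ∪ X) := by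
    intro X hX
    have := delta_submodular B (B' ∪ X)
    have e1 : B ∪ (B' ∪ X) = B ∪ X := by
      rw [← Finset.union_assoc, Finset.union_eq_left.2 hB.1]
    have e2 : B ∩ (B' ∪ X) = B' := by
      rw [Finset.inter_union_distrib_left, Finset.inter_eq_right.2 hB.1,
        Finset.disjoint_iff_inter_eq_empty.1 (hd.mono_right hX), Finset.union_empty]
    rwa [e1, e2] at this
  have hpos : ∀ Y, B' ⊆ Y → Y ⊆ B' ∪ C → Y ≠ B' → Y ≠ B' ∪ C → delta B' + 1 ≤ delta Y := by
    intro Y h1 h2 h3 h4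
    have hY : Y = B' ∪ (Y ∩ C) := by
      ext x
      have := @h1 x
      have := @h2 x
      simp only [Finset.mem_union, Finset.mem_inter] at *
      tauto
    have hne : (Y ∩ C).Nonempty := by
      rw [Finset.nonempty_iff_ne_empty]
      intro h'
      rw [h', Finset.union_empty] at hY
      exact h3 hY
    have hss : Y ∩ C ⊂ C := Finset.inter_subset_right.ssubset_of_ne fun h' => by
      rw [h'] at hY
      exact h4 hY
    have := h.lt_of_proper hne hss
    have := hsub _ hss.1
    rw [hY]
    linarith
  have hC := hsub C subset_rfl
  rw [h.delta_eq] at hC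
  have h0 : delta (B' ∪ C) = delta B' := by linarith
  refine h.2 B' hB ⟨⟨hd.mono_left hB.1, h.nonempty, ⟨Finset.subset_union_left, ?_⟩, ?_⟩,
    by linarith⟩
  · intro Y h1 h2
    by_cases h3 : Y = B'
    · rw [h3]
    by_cases h4 : Y = B' ∪ C
    · rw [h4, h0]
    linarith [hpos Y h1 h2 h3 h4]
  · rintro ⟨A, hA1, hA2, -, hA4⟩
    have := hA4.2 (B' ∪ C) hA2.1 subset_rfl
    have := hpos A hA1.1 hA2.1 hA1.ne' hA2.ne
    linarith

/-- Every point of the base of a good pair is collinear with some pair meeting `C`. -/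
theorem IsGood.exists_R {B C : Finset M} (h : IsGood B C) {b : M} (hb : b ∈ B) :
    ∃ c ∈ C, ∃ x ∈ B ∪ C, R b c x := by
  by_contra hcon
  push Not at hcon
  have hd := h.disjoint
  have hbC : b ∉ C := Finset.disjoint_left.1 hd hb
  have hlt := h.lt_of_base (Finset.erase_ssubset hb)
  have eU : B ∪ (B.erase b ∪ C) = B ∪ C := by
    rw [← Finset.union_assoc, Finset.union_eq_left.2 (Finset.erase_subset _ _)]
  have eI : B ∩ (B.erase b ∪ C) = B.erase b := by
    rw [Finset.inter_union_distrib_left, Finset.inter_eq_right.2 (Finset.erase_subset _ _),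
      Finset.disjoint_iff_inter_eq_empty.1 hd, Finset.union_empty]
  have hf := delta_free (A := B) (B := B.erase b ∪ C) (by
    rw [eU]
    intro x hx y hy z hz hR
    by_contra hno
    have hx' := hx
    have hy' := hy
    have hz' := hz
    simp only [Finset.mem_union, Finset.mem_erase] at hx' hy' hz' hno
    have h1 : x = b ∨ y = b ∨ z = b := by tauto
    have h2 : x ∈ C ∨ y ∈ C ∨ z ∈ C := by tauto
    rcases h1 with rfl | rfl | rfl <;> rcases h2 with h2 | h2 | h2 <;>
      try contradiction
    · exact hcon _ h2 _ hz hR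
    · exact hcon _ h2 _ hy (swap (rot (rot hR)))
    · exact hcon _ h2 _ hz (swap hR)
    · exact hcon _ h2 _ hx (rot hR)
    · exact hcon _ h2 _ hy (rot (rot hR))
    · exact hcon _ h2 _ hx (swap (rot hR)))
  rw [eU, eI, h.delta_eq] at hf
  linarith

/-- For `|C| ≥ 2`, no point of `C` lies on a line of the base. -/
theorem IsGood.not_R {B C : Finset M} (h : IsGood B C) (h2 : 2 ≤ C.card) {x y c : M}
    (hx : x ∈ B) (hy : y ∈ B) (hc : c ∈ C) : ¬ R c x y := by
  intro hR
  have hcB : c ∉ B := Finset.disjoint_right.1 h.disjoint hc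
  have h1 := delta_insert_le_of_R hcB hx hy hR
  have h3 := h.lt_of_proper (X := {c}) (by simp)
    ((Finset.singleton_subset_iff.2 hc).ssubset_of_ne fun e => by
      rw [← e, Finset.card_singleton] at h2
      omega)
  rw [Finset.union_comm, ← Finset.insert_eq] at h3
  linarith

/-- For `|C| ≥ 2`, every point of the base lies on a line with two points of `C`. -/
theorem IsGood.exists_R₂ {B C : Finset M} (h : IsGood B C) (h2 : 2 ≤ C.card) {b : M}
    (hb : b ∈ B) : ∃ c ∈ C, ∃ c' ∈ C, R b c c' := by
  obtain ⟨c, hc, x, hx, hR⟩ := h.exists_R hb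
  rcases Finset.mem_union.1 hx with hx | hx
  · exact absurd (swap hR) (h.not_R h2 hb hx hc)
  · exact ⟨c, hc, x, hx, hR⟩

/-- A line containing a point of `C` meets the base of a good pair in at most one point. -/
theorem IsGood.line_base {B C L U : Finset M} (h : IsGood B C) (h2 : 2 ≤ C.card)
    (hL : L ∈ lines U) {c : M} (hc : c ∈ C) (hcL : c ∈ L) : (L ∩ B).card ≤ 1 := by
  rw [Finset.card_le_one]
  intro x hx y hy
  by_contra hxy
  rw [Finset.mem_inter] at hx hy
  have hcB : c ∉ B := Finset.disjoint_right.1 h.disjoint hc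
  exact h.not_R h2 hx.2 hy.2 hc ((mem_lines.1 hL).2.2.1 c hcL x hx.1 y hy.1
    (fun e => hcB (e ▸ hx.2)) (fun e => hcB (e ▸ hy.2)) hxy)

/-- Over a set `D ⊇ B` whose predimension `C` does not lower, the points of `C` have no
collinearities besides those in `B ∪ C`. -/
theorem IsGood.mem_of_R {B C D : Finset M} (h : IsGood B C) (h2 : 2 ≤ C.card) (hBD : B ⊆ D)
    (hCD : Disjoint D C) (hδ : delta D ≤ delta (D ∪ C)) {c x y : M} (hc : c ∈ C)
    (hx : x ∈ D ∪ C) (hy : y ∈ D ∪ C) (hR : R c x y) : x ∈ B ∪ C := by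
  by_contra hxn
  have hxD : x ∈ D := (Finset.mem_union.1 hx).resolve_right
    fun h' => hxn (Finset.mem_union_right _ h')
  have eU : D ∪ (B ∪ C) = D ∪ C := by
    rw [← Finset.union_assoc, Finset.union_eq_left.2 hBD]
  have eI : D ∩ (B ∪ C) = B := by
    rw [Finset.inter_union_distrib_left, Finset.inter_eq_right.2 hBD,
      Finset.disjoint_iff_inter_eq_empty.1 hCD, Finset.union_empty]
  obtain ⟨L, hL, hcL, hxL, hyL, h3⟩ := exists_line_of_R (U := D ∪ (B ∪ C)) hR
    (by simp [hc]) (by rw [eU]; exact hx) (by rw [eU]; exact hy)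
  have := delta_add_card_le (A := D) (B := B ∪ C) {L} (by
    intro L' hL'
    rw [Finset.mem_singleton] at hL'
    subst hL'
    refine ⟨hL, ⟨c, hcL, Finset.disjoint_right.1 hCD hc⟩, ⟨x, hxL, hxn⟩, h3, ?_⟩
    rw [eI]
    exact h.line_base h2 hL hc hcL)
  rw [eU, eI, h.delta_eq, Finset.card_singleton] at this
  push_cast at this
  linarith

theorem IsStrong.delta_le_of_mem_iff {S : Set M} (h : IsStrong S) {A X : Finset M}
    (hA : ∀ x, x ∈ A ↔ x ∈ X ∧ x ∈ S) : delta A ≤ delta X := by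
  have := h X A (Set.ext fun x => hA x)
  exact this.2 X this.1 subset_rfl

/-- A good extension whose base lies in a strong set is inside or outside that set. -/
theorem IsGood.subset_or_disjoint {B C : Finset M} (h : IsGood B C) {S : Set M}
    (hS : IsStrong S) (hB : (B : Set M) ⊆ S) :
    (C : Set M) ⊆ S ∨ ∀ c ∈ C, c ∉ S := by
  have hd := h.disjoint
  rcases h.1.eq_of_delta_le (X := (B ∪ C).filter (· ∈ S))
    (fun b hb => Finset.mem_filter.2 ⟨Finset.mem_union_left _ hb, hB hb⟩)
    (Finset.filter_subset _ _)
    ((hS.delta_le_of_mem_iff fun x => Finset.mem_filter).trans h.delta_eq.le) with h' | h'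
  · refine Or.inr fun c hc hcS => Finset.disjoint_right.1 hd hc ?_
    rw [← h']
    exact Finset.mem_filter.2 ⟨Finset.mem_union_right _ hc, hcS⟩
  · refine Or.inl fun c hc => ?_
    have : c ∈ (B ∪ C).filter (· ∈ S) := by
      rw [h']
      exact Finset.mem_union_right _ hc
    exact (Finset.mem_filter.1 this).2

/-- Disjoint good extensions of `B` that are split by `S` each cost one unit over `S ∪ B`. -/
theorem delta_union_add_card_le {B S : Finset M} (𝒞 : Finset (Finset M))
    (hg : ∀ X ∈ 𝒞, IsGood B X) (hd : (𝒞 : Set (Finset M)).PairwiseDisjoint id)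
    (hm : ∀ X ∈ 𝒞, (X ∩ S).Nonempty ∧ ¬ X ⊆ S) :
    delta (S ∪ B ∪ 𝒞.biUnion id) + 𝒞.card ≤ delta (S ∪ B) := by
  induction 𝒞 using Finset.induction_on with
  | empty => simp
  | insert X 𝒞 hX ih =>
    have ih' := ih (fun Y hY => hg Y (Finset.mem_insert_of_mem hY))
      (hd.subset (by simp)) (fun Y hY => hm Y (Finset.mem_insert_of_mem hY))
    have hgX := hg X (Finset.mem_insert_self _ _)
    have hmX := hm X (Finset.mem_insert_self _ _)
    have hdX := hgX.disjoint
    have hrest : ∀ x ∈ X, x ∉ 𝒞.biUnion id := by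
      intro x hx hx'
      obtain ⟨Y, hY, hxY⟩ := Finset.mem_biUnion.1 hx'
      have hne : X ≠ Y := fun e => hX (e ▸ hY)
      exact Finset.disjoint_left.1
        (hd (by simp) (by simp [hY]) hne : Disjoint X Y) hx hxY
    have eI : (S ∪ B ∪ 𝒞.biUnion id) ∩ (B ∪ X) = B ∪ (X ∩ S) := by
      ext x
      have := hrest x
      simp only [Finset.mem_inter, Finset.mem_union] at this ⊢
      tauto
    have eU : (S ∪ B ∪ 𝒞.biUnion id) ∪ (B ∪ X) = S ∪ B ∪ (insert X 𝒞).biUnion id := by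
      ext x
      simp only [Finset.biUnion_insert, Finset.mem_union, id]
      tauto
    have h1 := delta_submodular (S ∪ B ∪ 𝒞.biUnion id) (B ∪ X)
    have h2 := hgX.lt_of_proper hmX.1 (Finset.inter_subset_left.ssubset_of_ne
      fun e => hmX.2 (Finset.inter_eq_left.1 e))
    rw [eI, eU, hgX.delta_eq] at h1
    rw [Finset.card_insert_of_notMem hX]
    push_cast
    linarith

end Predimension

end CollSpace

namespace CollSpace

section Embeddings

open Classical

variable {M : Type u} {N : Type v} {L : Type w} [CollSpace M] [CollSpace N] [CollSpace L]

/-! ### Embeddings and strong substructures -/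

/-- The underlying embedding of types of an embedding of linear spaces. -/
def Emb.emb (f : Emb M N) : M ↪ N := ⟨f.toFun, f.inj⟩

@[simp] theorem Emb.emb_apply (f : Emb M N) (x : M) : f.emb x = f.toFun x := rfl

/-- Composition of embeddings. -/
def Emb.comp (g : Emb N L) (f : Emb M N) : Emb M L where
  toFun := g.toFun ∘ f.toFun
  inj := g.inj.comp f.inj
  map_R _ _ _ := (g.map_R _ _ _).trans (f.map_R _ _ _)

/-- The inclusion of a substructure. -/
def Emb.incl (p : M → Prop) : Emb (Subtype p) M where
  toFun := Subtype.val
  inj := Subtype.val_injective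
  map_R _ _ _ := Iff.rfl

/-- An embedding with values in the image of another embedding factors through it. -/
theorem Emb.exists_lift (g : Emb N L) (f : Emb M L) (h : ∀ x, f.toFun x ∈ Set.range g.toFun) :
    ∃ k : Emb M N, ∀ x, g.toFun (k.toFun x) = f.toFun x := by
  choose k hk using h
  refine ⟨⟨k, fun x y e => f.inj (by rw [← hk, ← hk, e]), fun x y z => ?_⟩, hk⟩
  rw [← g.map_R, hk, hk, hk, f.map_R]

theorem Emb.isLine_map (f : Emb M N) {A ℓ : Finset M} :
    IsLine (A.map f.emb) (ℓ.map f.emb) ↔ IsLine A ℓ := by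
  have hm : ∀ (S : Finset M) (z : M), f.toFun z ∈ S.map f.emb ↔ z ∈ S :=
    fun S z => Finset.mem_map' f.emb
  unfold IsLine
  simp only [Finset.map_subset_map, Finset.card_map, Finset.forall_mem_map, Emb.emb_apply,
    f.map_R, f.inj.ne_iff, hm]

@[simp] theorem delta_map (f : Emb M N) (A : Finset M) : delta (A.map f.emb) = delta A := by
  unfold delta
  rw [Finset.card_map]
  congr 1
  symm
  refine Finset.sum_bij (fun ℓ _ => ℓ.map f.emb) ?_ ?_ ?_ ?_
  · intro ℓ hℓ
    exact mem_lines.2 (f.isLine_map.2 (mem_lines.1 hℓ))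
  · intro a _ b _ e
    exact Finset.map_injective _ e
  · intro ℓ hℓ
    obtain ⟨ℓ', -, rfl⟩ := Finset.subset_map_iff.1 (mem_lines.1 hℓ).1
    exact ⟨ℓ', mem_lines.2 (f.isLine_map.1 (mem_lines.1 hℓ)), rfl⟩
  · intro ℓ _
    rw [Finset.card_map]

theorem Emb.exists_map_eq (f : Emb M N) {A : Finset N} (h : (A : Set N) ⊆ Set.range f.toFun) :
    ∃ A' : Finset M, A'.map f.emb = A := by
  refine ⟨A.preimage f.toFun f.inj.injOn, ?_⟩
  ext x
  simp only [Finset.mem_map, Finset.mem_preimage, Emb.emb_apply]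
  constructor
  · rintro ⟨y, hy, rfl⟩
    exact hy
  · intro hx
    obtain ⟨y, rfl⟩ := h hx
    exact ⟨y, hx, rfl⟩

theorem isStrong_iff {S : Set M} :
    IsStrong S ↔ ∀ X : Finset M, delta (X.filter (· ∈ S)) ≤ delta X := by
  constructor
  · intro h X
    exact (h X (X.filter (· ∈ S)) (by ext; simp)).2 X (Finset.filter_subset _ _) subset_rfl
  · intro h X A hA
    have hA' : A = X.filter (· ∈ S) := by
      apply Finset.coe_injective
      rw [hA]
      ext
      simp
    subst hA'
    refine ⟨Finset.filter_subset _ _, fun Y hY hYX => ?_⟩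
    have : X.filter (· ∈ S) = Y.filter (· ∈ S) := by
      ext x
      simp only [Finset.mem_filter]
      exact ⟨fun hx => ⟨hY (Finset.mem_filter.2 hx), hx.2⟩, fun hx => ⟨hYX hx.1, hx.2⟩⟩
    rw [this]
    exact h Y

theorem isStrong_univ : IsStrong (Set.univ : Set M) := by
  rw [isStrong_iff]
  intro X
  simp

/-- An embedding pulls strong substructures back to strong substructures. -/
theorem IsStrong.preimage (f : Emb M N) {S : Set N} (h : IsStrong S) :
    IsStrong (f.toFun ⁻¹' S) := by
  rw [isStrong_iff] at h ⊢
  intro X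
  have := h (X.map f.emb)
  rwa [Finset.filter_map, delta_map, delta_map] at this

theorem IsStrong.image (f : StrongEmb M N) {S : Set M} (h : IsStrong S) :
    IsStrong (f.toFun '' S) := by
  have hf := f.strong
  rw [isStrong_iff] at h hf ⊢
  intro X
  refine le_trans ?_ (hf X)
  obtain ⟨Y, hY⟩ := f.toEmb.exists_map_eq (A := X.filter (· ∈ Set.range f.toFun))
    (by intro x hx; exact (Finset.mem_filter.1 hx).2)
  have : X.filter (· ∈ f.toFun '' S) = (Y.filter (· ∈ S)).map f.toEmb.emb := by
    ext x
    have hx : x ∈ Y.map f.toEmb.emb ↔ x ∈ X.filter (· ∈ Set.range f.toFun) := by rw [hY]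
    simp only [Finset.mem_map, Finset.mem_filter, Emb.emb_apply, Set.mem_image,
      Set.mem_range] at hx ⊢
    constructor
    · rintro ⟨h1, y, hy, rfl⟩
      obtain ⟨a, ha, e⟩ := hx.2 ⟨h1, y, rfl⟩
      obtain rfl := f.inj e
      exact ⟨a, ⟨ha, hy⟩, rfl⟩
    · rintro ⟨a, ⟨ha, haS⟩, rfl⟩
      exact ⟨(hx.1 ⟨a, ha, rfl⟩).1, a, haS, rfl⟩
  rw [this, delta_map, ← hY, delta_map]
  exact h Y

/-- Composition of strong embeddings. -/
def StrongEmb.comp (g : StrongEmb N L) (f : StrongEmb M N) : StrongEmb M L where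
  toEmb := g.toEmb.comp f.toEmb
  strong := by
    have := IsStrong.image g f.strong
    rwa [← Set.range_comp] at this

@[simp] theorem StrongEmb.comp_apply (g : StrongEmb N L) (f : StrongEmb M N) (x : M) :
    (g.comp f).toFun x = g.toFun (f.toFun x) := rfl

variable (M) in
/-- The identity as a strong embedding. -/
def StrongEmb.refl : StrongEmb M M where
  toFun := id
  inj := Function.injective_id
  map_R _ _ _ := Iff.rfl
  strong := by
    rw [Set.range_id]
    exact isStrong_univ

/-- The inclusion of a strong substructure. -/
def StrongEmb.incl {p : M → Prop} (h : IsStrong {x | p x}) : StrongEmb (Subtype p) M where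
  toEmb := Emb.incl p
  strong := by
    have : Set.range (Emb.incl p).toFun = {x | p x} := Subtype.range_coe
    rwa [this]

/-- If `g ∘ k = f` with `f` strong, then `k` is strong. -/
theorem Emb.isStrong_range_of_comp (g : Emb N L) (k : Emb M N) (f : StrongEmb M L)
    (h : ∀ x, g.toFun (k.toFun x) = f.toFun x) : IsStrong (Set.range k.toFun) := by
  have := f.strong.preimage g
  have e : g.toFun ⁻¹' Set.range f.toFun = Set.range k.toFun := by
    ext x
    constructor
    · rintro ⟨y, hy⟩
      exact ⟨y, g.inj (by rw [h, hy])⟩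
    · rintro ⟨y, rfl⟩
      exact ⟨y, (h y).symm⟩
  rwa [e] at this

/-- A strong embedding with values in the image of an embedding factors through it as a
strong embedding. -/
theorem StrongEmb.exists_lift (g : Emb N L) (f : StrongEmb M L)
    (h : ∀ x, f.toFun x ∈ Set.range g.toFun) :
    ∃ k : StrongEmb M N, ∀ x, g.toFun (k.toFun x) = f.toFun x := by
  obtain ⟨k, hk⟩ := g.exists_lift f.toEmb h
  exact ⟨⟨k, g.isStrong_range_of_comp k f hk⟩, hk⟩

/-- A surjective embedding is inverted by a strong embedding. -/
theorem Emb.exists_inverse (f : Emb M N) (h : Function.Surjective f.toFun) :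
    ∃ k : StrongEmb N M, (∀ x, f.toFun (k.toFun x) = x) ∧ ∀ x, k.toFun (f.toFun x) = x := by
  obtain ⟨k, hk⟩ := StrongEmb.exists_lift f (StrongEmb.refl N) h
  exact ⟨k, hk, fun x => f.inj (hk _)⟩

theorem StrongEmb.delta_le (f : StrongEmb M N) [Fintype M] {X : Finset N}
    (hX : (Finset.univ : Finset M).map f.toEmb.emb ⊆ X) :
    delta (Finset.univ : Finset M) ≤ delta X := by
  have h := isStrong_iff.1 f.strong X
  rw [← delta_map f.toEmb]
  refine le_trans (le_of_eq (congrArg delta ?_)) h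
  ext x
  simp only [Finset.mem_filter, Finset.mem_map, Set.mem_range, Finset.mem_univ, true_and,
    Emb.emb_apply]
  refine ⟨fun ⟨y, hy⟩ => ⟨?_, y, hy⟩, fun h => h.2⟩
  subst hy
  exact hX (Finset.mem_map_of_mem _ (Finset.mem_univ _))

theorem Emb.isStrong_of_delta_le (f : Emb M N) [Fintype M]
    (h : ∀ X : Finset N, (Finset.univ : Finset M).map f.emb ⊆ X →
      delta (Finset.univ : Finset M) ≤ delta X) : IsStrong (Set.range f.toFun) := by
  have e : Set.range f.toFun = ((Finset.univ.map f.emb : Finset N) : Set N) := by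
    ext
    simp
  rw [e, isStrong_coe_iff]
  intro X hX
  rw [delta_map]
  exact h X hX

theorem isZeroPrimitive_map (f : Emb M N) {B C : Finset M} :
    IsZeroPrimitive (B.map f.emb) (C.map f.emb) ↔ IsZeroPrimitive B C := by
  have hLe : ∀ A A' : Finset M, Le (A.map f.emb) (A'.map f.emb) ↔ Le A A' := by
    intro A A'
    unfold Le
    rw [Finset.map_subset_map]
    refine and_congr_right fun _ => ⟨fun h X h1 h2 => ?_, fun h X h1 h2 => ?_⟩
    · have := h (X.map f.emb) (Finset.map_subset_map.2 h1) (Finset.map_subset_map.2 h2)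
      rwa [delta_map, delta_map] at this
    · obtain ⟨X', -, rfl⟩ := Finset.subset_map_iff.1 h2
      rw [delta_map, delta_map]
      exact h X' (Finset.map_subset_map.1 h1) (Finset.map_subset_map.1 h2)
  unfold IsZeroPrimitive IsPrimitive
  rw [← Finset.map_union, hLe, Finset.disjoint_map, Finset.map_nonempty, delta_map, delta_map]
  refine and_congr_left fun _ => and_congr_right fun _ => and_congr_right fun _ =>
    and_congr_right fun _ => not_congr ⟨?_, ?_⟩
  · rintro ⟨A, h1, h2, h3, h4⟩
    obtain ⟨A', -, rfl⟩ := Finset.subset_map_iff.1 h2.1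
    rw [hLe] at h3 h4
    exact ⟨A', Finset.map_ssubset_map.1 h1, Finset.map_ssubset_map.1 h2, h3, h4⟩
  · rintro ⟨A, h1, h2, h3, h4⟩
    exact ⟨A.map f.emb, Finset.map_ssubset_map.2 h1, Finset.map_ssubset_map.2 h2,
      (hLe _ _).2 h3, (hLe _ _).2 h4⟩

theorem IsGood.map (f : Emb M N) {B C : Finset M} (h : IsGood B C) :
    IsGood (B.map f.emb) (C.map f.emb) := by
  refine ⟨(isZeroPrimitive_map f).2 h.1, fun B' hB' hz => ?_⟩
  obtain ⟨B'', -, rfl⟩ := Finset.subset_map_iff.1 hB'.1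
  exact h.2 B'' (Finset.map_ssubset_map.1 hB') ((isZeroPrimitive_map f).1 hz)

/-! ### The multiplicity bounds -/

/-- The substructure on `S` belongs to `K̂_μ`: finite subsets of `S` have nonnegative
predimension, and any family of pairwise disjoint copies of `C` over `B` inside `S` has at most
`μ(B, C)` members. -/
def BoundedIn (μ : GoodPair → ℕ) (S : Set M) : Prop :=
  (∀ A : Finset M, (A : Set M) ⊆ S → 0 ≤ delta A) ∧
    ∀ (P : GoodPair) (e : Emb P.base M) (𝒞 : Finset (Finset M)), (∀ b, e.toFun b ∈ S) →
      (∀ X ∈ 𝒞, IsCopy P e X ∧ (X : Set M) ⊆ S) →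
      (𝒞 : Set (Finset M)).PairwiseDisjoint id → 𝒞.card ≤ μ P

theorem chi_le_iff {P : GoodPair} {e : Emb P.base M} {n : ℕ} :
    chi P e ≤ n ↔ ∀ 𝒞 : Finset (Finset M), (∀ X ∈ 𝒞, IsCopy P e X) →
      (𝒞 : Set (Finset M)).PairwiseDisjoint id → 𝒞.card ≤ n := by
  unfold chi
  rw [iSup_le_iff]
  simp only [Nat.cast_le, Subtype.forall, and_imp]

theorem IsCopy.map (k : Emb M N) {P : GoodPair} {e : Emb P.base M} {X : Finset M}
    (h : IsCopy P e X) : IsCopy P (k.comp e) (X.map k.emb) := by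
  obtain ⟨f, hf, hX⟩ := h
  refine ⟨k.comp f, fun b => congrArg k.toFun (hf b), ?_⟩
  rw [Finset.coe_map, hX, ← Set.image_comp]
  rfl

theorem IsCopy.of_map (k : Emb M N) {P : GoodPair} {e : Emb P.base M} {X : Finset M}
    (h : IsCopy P (k.comp e) (X.map k.emb)) : IsCopy P e X := by
  obtain ⟨f, hf, hX⟩ := h
  obtain ⟨f', hf'⟩ := k.exists_lift f (by
    intro c
    by_cases hc : c ∈ P.base
    · exact ⟨_, (hf ⟨c, hc⟩).symm⟩
    · have : f.toFun c ∈ ((X.map k.emb : Finset N) : Set N) := by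
        rw [hX]
        exact ⟨c, hc, rfl⟩
      simp only [Finset.coe_map, Set.mem_image] at this
      obtain ⟨x, -, hx⟩ := this
      exact ⟨x, hx⟩)
  refine ⟨f', fun b => k.inj ((hf' _).trans (hf b)), ?_⟩
  have hinj : Function.Injective (fun s : Set M => k.toFun '' s) := k.inj.image_injective
  apply hinj
  have e1 : k.toFun '' (X : Set M) = ((X.map k.emb : Finset N) : Set N) := by
    rw [Finset.coe_map]
    rfl
  show k.toFun '' (X : Set M) = k.toFun '' _
  rw [e1, hX, Set.image_image]
  simp only [hf']

/-- The bounds `χ ≤ μ` for a structure, seen inside an ambient structure. -/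
theorem card_le_of_chi_le {μ : GoodPair → ℕ} (k : Emb M N)
    (h : ∀ (P : GoodPair) (e : Emb P.base M), chi P e ≤ (μ P : ℕ∞))
    (P : GoodPair) (e : Emb P.base N) (𝒞 : Finset (Finset N))
    (he : ∀ b, e.toFun b ∈ Set.range k.toFun)
    (hC : ∀ X ∈ 𝒞, IsCopy P e X ∧ (X : Set N) ⊆ Set.range k.toFun)
    (hd : (𝒞 : Set (Finset N)).PairwiseDisjoint id) : 𝒞.card ≤ μ P := by
  obtain ⟨e', he'⟩ := k.exists_lift e he
  have hinj : Function.Injective (fun X : Finset M => X.map k.emb) := Finset.map_injective _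
  have hcomp : k.comp e' = e := by
    cases e
    simp only [Emb.comp, Emb.mk.injEq]
    exact funext he'
  have hex : ∃ 𝒞' : Finset (Finset M), 𝒞'.map ⟨_, hinj⟩ = 𝒞 := by
    refine ⟨𝒞.preimage _ hinj.injOn, ?_⟩
    ext X
    simp only [Finset.mem_map, Finset.mem_preimage, Function.Embedding.coeFn_mk]
    constructor
    · rintro ⟨y, hy, rfl⟩
      exact hy
    · intro hX
      obtain ⟨Y, rfl⟩ := k.exists_map_eq (hC X hX).2
      exact ⟨Y, hX, rfl⟩
  obtain ⟨𝒞', rfl⟩ := hex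
  rw [Finset.card_map]
  refine chi_le_iff.1 (h P e') 𝒞' (fun X hX => ?_) (fun X hX Y hY hne => ?_)
  · have := (hC (X.map k.emb) (Finset.mem_map_of_mem _ hX)).1
    rw [← hcomp] at this
    exact this.of_map k
  · have := hd (Finset.mem_coe.2 (Finset.mem_map_of_mem ⟨_, hinj⟩ hX))
      (Finset.mem_coe.2 (Finset.mem_map_of_mem ⟨_, hinj⟩ hY)) (fun e => hne (hinj e))
    exact (Finset.disjoint_map k.emb).1 this

theorem BoundedIn.chi_le {μ : GoodPair → ℕ} (k : Emb M N)
    (h : BoundedIn μ (Set.range k.toFun)) (P : GoodPair) (e : Emb P.base M) :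
    chi P e ≤ (μ P : ℕ∞) := by
  rw [chi_le_iff]
  intro 𝒞 hC hd
  have hinj : Function.Injective (fun X : Finset M => X.map k.emb) := Finset.map_injective _
  have := h.2 P (k.comp e) (𝒞.map ⟨_, hinj⟩) (fun b => ⟨_, rfl⟩) (by
    intro X hX
    obtain ⟨Y, hY, rfl⟩ := Finset.mem_map.1 hX
    refine ⟨(hC Y hY).map k, ?_⟩
    intro x hx
    simp only [Function.Embedding.coeFn_mk, Finset.coe_map, Set.mem_image] at hx
    obtain ⟨y, -, rfl⟩ := hx
    exact ⟨y, rfl⟩) (by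
    intro X hX Y hY hne
    obtain ⟨X, hX, rfl⟩ := Finset.mem_map.1 (Finset.mem_coe.1 hX)
    obtain ⟨Y, hY, rfl⟩ := Finset.mem_map.1 (Finset.mem_coe.1 hY)
    exact (Finset.disjoint_map k.emb).2 (hd ((Finset.mem_map' _).1 hX) ((Finset.mem_map' _).1 hY)
      fun e => hne (by rw [e])))
  rwa [Finset.card_map] at this

theorem InKHat0.of_emb (k : Emb M N) (h : InKHat0 N) : InKHat0 M := fun A => by
  rw [← delta_map k]
  exact h _

theorem InKmuHat.boundedIn_range {μ : GoodPair → ℕ} (h : InKmuHat μ M) (k : Emb M N) :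
    BoundedIn μ (Set.range k.toFun) := by
  refine ⟨fun A hA => ?_, fun P e 𝒞 he hC hd => ?_⟩
  · obtain ⟨A', rfl⟩ := k.exists_map_eq hA
    have := (h A').1.2 Finset.univ
    rw [delta_map, ← delta_map (Emb.incl (· ∈ A')) Finset.univ] at *
    convert this
    ext x
    simp [Emb.incl]
  · obtain ⟨W, hW⟩ := k.exists_map_eq
      (A := (Finset.univ.image e.toFun) ∪ 𝒞.biUnion id) (by
      intro x hx
      simp only [Finset.coe_union, Finset.coe_image, Finset.coe_univ, Set.image_univ,
        Set.mem_union, Set.mem_range, Finset.mem_coe, Finset.mem_biUnion, id] at hx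
      rcases hx with ⟨b, rfl⟩ | ⟨X, hX, hx⟩
      · exact he b
      · exact (hC X hX).2 hx)
    have hr : ∀ x ∈ (Finset.univ.image e.toFun) ∪ 𝒞.biUnion id,
        x ∈ Set.range (k.comp (Emb.incl (· ∈ W))).toFun := by
      intro x hx
      rw [← hW] at hx
      obtain ⟨y, hy, rfl⟩ := Finset.mem_map.1 hx
      exact ⟨⟨y, hy⟩, rfl⟩
    refine card_le_of_chi_le (k.comp (Emb.incl (· ∈ W))) (h W).2 P e 𝒞 (fun b => ?_)
      (fun X hX => ⟨(hC X hX).1, fun x hx => ?_⟩) hd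
    · exact hr _ (Finset.mem_union_left _ (Finset.mem_image_of_mem _ (Finset.mem_univ _)))
    · exact hr _ (Finset.mem_union_right _ (Finset.mem_biUnion.2 ⟨X, hX, hx⟩))

theorem BoundedIn.mono {μ : GoodPair → ℕ} {S T : Set M} (h : BoundedIn μ T) (hST : S ⊆ T) :
    BoundedIn μ S :=
  ⟨fun A hA => h.1 A (hA.trans hST), fun P e 𝒞 he hC hd =>
    h.2 P e 𝒞 (fun b => hST (he b)) (fun X hX => ⟨(hC X hX).1, (hC X hX).2.trans hST⟩) hd⟩

theorem BoundedIn.inKmuHat {μ : GoodPair → ℕ} (k : Emb M N)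
    (h : BoundedIn μ (Set.range k.toFun)) : InKmuHat μ M := by
  intro A
  have hr : Set.range (k.comp (Emb.incl (· ∈ A))).toFun ⊆ Set.range k.toFun := by
    rintro _ ⟨x, rfl⟩
    exact ⟨_, rfl⟩
  refine ⟨⟨inferInstance, fun X => ?_⟩, (h.mono hr).chi_le _⟩
  rw [← delta_map (k.comp (Emb.incl (· ∈ A)))]
  refine h.1 _ ?_
  intro x hx
  simp only [Finset.coe_map, Set.mem_image] at hx
  obtain ⟨y, -, rfl⟩ := hx
  exact ⟨_, rfl⟩

theorem InKmuHat.of_emb {μ : GoodPair → ℕ} (k : Emb M N) (h : InKmuHat μ N) : InKmuHat μ M :=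
  ((h.boundedIn_range (StrongEmb.refl N).toEmb).mono (by
    rintro _ ⟨x, rfl⟩
    exact ⟨_, rfl⟩)).inKmuHat k

theorem InKmu.inKmuHat {μ : GoodPair → ℕ} (h : InKmu μ M) : InKmuHat μ M := fun A => by
  refine ⟨⟨inferInstance, h.1.2.of_emb (Emb.incl (· ∈ A))⟩, fun P e => chi_le_iff.2 ?_⟩
  intro 𝒞 hC hd
  have hinj : Function.Injective (fun X : Finset A => X.map (Emb.incl (· ∈ A)).emb) :=
    Finset.map_injective _
  have := chi_le_iff.1 (h.2 P ((Emb.incl (· ∈ A)).comp e)) (𝒞.map ⟨_, hinj⟩) (by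
    intro X hX
    obtain ⟨Y, hY, rfl⟩ := Finset.mem_map.1 hX
    exact (hC Y hY).map _) (by
    intro X hX Y hY hne
    obtain ⟨X, hX, rfl⟩ := Finset.mem_map.1 (Finset.mem_coe.1 hX)
    obtain ⟨Y, hY, rfl⟩ := Finset.mem_map.1 (Finset.mem_coe.1 hY)
    exact (Finset.disjoint_map _).2 (hd ((Finset.mem_map' _).1 hX) ((Finset.mem_map' _).1 hY)
      fun e => hne (by rw [e])))
  rwa [Finset.card_map] at this

theorem InKmuHat.inKHat0 {μ : GoodPair → ℕ} (h : InKmuHat μ M) : InKHat0 M := fun A =>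
  (h.boundedIn_range (StrongEmb.refl M).toEmb).1 A fun x _ => ⟨x, rfl⟩

theorem InKmuHat.inKmu {μ : GoodPair → ℕ} [Finite M] (h : InKmuHat μ M) : InKmu μ M :=
  ⟨⟨inferInstance, h.inKHat0⟩,
    (h.boundedIn_range (StrongEmb.refl M).toEmb).chi_le (StrongEmb.refl M).toEmb⟩

end Embeddings

end CollSpace

namespace CollSpace

section FreeAmalgam

open Classical

variable {G : Type u} [CollSpace G]

/-! ### Copies of good pairs -/

theorem IsCopy.exists_emb {P : GoodPair} {e : Emb P.base G} {X : Finset G} (h : IsCopy P e X) :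
    ∃ f : Emb P.carrier G, Finset.univ.map e.emb = P.base.map f.emb ∧
      X = P.baseᶜ.map f.emb ∧ ∀ b : P.base, f.toFun b.1 = e.toFun b := by
  obtain ⟨f, hf, hX⟩ := h
  refine ⟨f, ?_, ?_, hf⟩
  · ext x
    simp only [Finset.mem_map, Finset.mem_univ, true_and, Emb.emb_apply]
    constructor
    · rintro ⟨b, rfl⟩
      exact ⟨b.1, b.2, hf b⟩
    · rintro ⟨c, hc, rfl⟩
      exact ⟨⟨c, hc⟩, (hf ⟨c, hc⟩).symm⟩
  · apply Finset.coe_injective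
    rw [hX]
    ext x
    simp [Emb.emb]

theorem IsCopy.isGood {P : GoodPair} {e : Emb P.base G} {X : Finset G} (h : IsCopy P e X) :
    IsGood (Finset.univ.map e.emb) X := by
  obtain ⟨f, hB, hX, -⟩ := h.exists_emb
  rw [hB, hX]
  exact P.good.map f

theorem IsCopy.card_eq {P : GoodPair} {e : Emb P.base G} {X : Finset G} (h : IsCopy P e X) :
    X.card = P.baseᶜ.card := by
  obtain ⟨f, -, hX, -⟩ := h.exists_emb
  rw [hX, Finset.card_map]

theorem IsCopy.delta_base {P : GoodPair} {e : Emb P.base G} {X : Finset G} (h : IsCopy P e X) :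
    delta (Finset.univ.map e.emb) = delta P.base := by
  obtain ⟨f, hB, -, -⟩ := h.exists_emb
  rw [hB, delta_map]

/-- Two copies of `C` over `B` are isomorphic over `B`. -/
theorem IsCopy.exists_iso {P : GoodPair} {e : Emb P.base G} {X Y : Finset G}
    (hX : IsCopy P e X) (hY : IsCopy P e Y) :
    ∃ φ : G → G, (∀ b ∈ Finset.univ.map e.emb, φ b = b) ∧ (∀ x ∈ X, φ x ∈ Y) ∧
      Set.InjOn φ X ∧
      ∀ x ∈ Finset.univ.map e.emb ∪ X, ∀ y ∈ Finset.univ.map e.emb ∪ X,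
        ∀ z ∈ Finset.univ.map e.emb ∪ X, R (φ x) (φ y) (φ z) ↔ R x y z := by
  obtain ⟨f, hfB, rfl, hf⟩ := hX.exists_emb
  obtain ⟨k, -, rfl, hk⟩ := hY.exists_emb
  have hext : ∀ c, Function.extend f.toFun k.toFun id (f.toFun c) = k.toFun c :=
    fun c => f.inj.extend_apply _ _ _
  have hran : ∀ x ∈ Finset.univ.map e.emb ∪ P.baseᶜ.map f.emb, ∃ c, f.toFun c = x := by
    intro x hx
    rw [hfB] at hx
    simp only [Finset.mem_union, Finset.mem_map, Emb.emb_apply] at hx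
    rcases hx with ⟨c, -, h⟩ | ⟨c, -, h⟩ <;> exact ⟨c, h⟩
  refine ⟨Function.extend f.toFun k.toFun id, ?_, ?_, ?_, ?_⟩
  · intro b hb
    obtain ⟨b, -, rfl⟩ := Finset.mem_map.1 hb
    rw [Emb.emb_apply, ← hf, hext, hk, hf]
  · intro x hx
    obtain ⟨c, hc, rfl⟩ := Finset.mem_map.1 hx
    rw [Emb.emb_apply, hext]
    exact Finset.mem_map_of_mem k.emb hc
  · intro x hx y hy hxy
    obtain ⟨c, -, rfl⟩ := Finset.mem_map.1 (Finset.mem_coe.1 hx)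
    obtain ⟨d, -, rfl⟩ := Finset.mem_map.1 (Finset.mem_coe.1 hy)
    rw [Emb.emb_apply, Emb.emb_apply, hext, hext] at hxy
    rw [k.inj hxy]
  · intro x hx y hy z hz
    obtain ⟨x, rfl⟩ := hran x hx
    obtain ⟨y, rfl⟩ := hran y hy
    obtain ⟨z, rfl⟩ := hran z hz
    rw [hext, hext, hext, k.map_R, f.map_R]

/-! ### Free amalgams -/

/-- The structure is a free amalgam of its substructure `F` and its finite substructure `E` over
`D = E ∩ F`: every collinear triple lies in `F` or in `E`, and `D` is strong in both. -/
structure FreeAmalgam (F : Set G) (E D : Finset G) : Prop where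
  mem_iff : ∀ x, x ∈ D ↔ x ∈ E ∧ x ∈ F
  cover : ∀ x, x ∈ F ∨ x ∈ E
  free : ∀ x y z, R x y z → (x ∈ F ∧ y ∈ F ∧ z ∈ F) ∨ (x ∈ E ∧ y ∈ E ∧ z ∈ E)
  le_left : ∀ X, D ⊆ X → X ⊆ E → delta D ≤ delta X
  le_right : ∀ X : Finset G, D ⊆ X → (X : Set G) ⊆ F → delta D ≤ delta X

namespace FreeAmalgam

variable {F : Set G} {E D : Finset G}

/-- The predimension of any finite set is modular with respect to its traces on `F` and `E`. -/
theorem delta_add (h : FreeAmalgam F E D) (X : Finset G) :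
    delta X + delta (X ∩ D) = delta (X.filter (· ∈ F)) + delta (X ∩ E) := by
  have eU : X.filter (· ∈ F) ∪ X ∩ E = X := by
    ext x
    have := h.cover x
    simp only [Finset.mem_union, Finset.mem_filter, Finset.mem_inter]
    tauto
  have eI : X.filter (· ∈ F) ∩ (X ∩ E) = X ∩ D := by
    ext x
    have := h.mem_iff x
    simp only [Finset.mem_filter, Finset.mem_inter]
    tauto
  have := delta_free (A := X.filter (· ∈ F)) (B := X ∩ E) (by
    rw [eU]
    intro x hx y hy z hz hR
    have := h.free x y z hR
    simp only [Finset.mem_filter, Finset.mem_inter]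
    tauto)
  rwa [eU, eI] at this

/-- If `S` does not lower the predimension of `D`, neither does it lower that of its trace
on `D`. -/
theorem delta_inter_le {D S X : Finset G} (hXS : X ∩ D = S ∩ D) (h : delta D ≤ delta (D ∪ S)) :
    delta (X ∩ D) ≤ delta S := by
  have := delta_submodular D S
  rw [hXS, Finset.inter_comm]
  linarith

theorem strong_right (h : FreeAmalgam F E D) : IsStrong F := by
  refine isStrong_iff.2 fun X => ?_
  have h1 := h.delta_add X
  have h2 : delta (X ∩ D) ≤ delta (X ∩ E) := delta_inter_le (by
    ext x
    have := h.mem_iff x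
    simp only [Finset.mem_inter]
    tauto) (h.le_left _ Finset.subset_union_left
      (Finset.union_subset (fun x hx => ((h.mem_iff x).1 hx).1) Finset.inter_subset_right))
  linarith

theorem strong_left (h : FreeAmalgam F E D) : IsStrong (E : Set G) := by
  refine isStrong_iff.2 fun X => ?_
  have h1 := h.delta_add X
  have h2 : delta (X ∩ D) ≤ delta (X.filter (· ∈ F)) := delta_inter_le (by
    ext x
    have := h.mem_iff x
    simp only [Finset.mem_inter, Finset.mem_filter]
    tauto) (h.le_right _ Finset.subset_union_left (by
      intro x hx
      rcases Finset.mem_union.1 (Finset.mem_coe.1 hx) with hx | hx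
      · exact ((h.mem_iff x).1 hx).2
      · exact (Finset.mem_filter.1 hx).2))
  refine le_trans (le_of_eq (congrArg delta ?_)) (by linarith : delta (X ∩ E) ≤ delta X)
  ext
  simp

/-- Over a base `B`, at most `δ(B)` pairwise disjoint good extensions are split by a strong
substructure. -/
theorem card_le_of_split (hpos : ∀ X : Finset G, 0 ≤ delta X) {S : Set G}
    (hS : IsStrong S) {B : Finset G}
    {𝒞 : Finset (Finset G)} (hg : ∀ X ∈ 𝒞, IsGood B X)
    (hd : (𝒞 : Set (Finset G)).PairwiseDisjoint id)
    (hm : ∀ X ∈ 𝒞, (∃ x ∈ X, x ∈ S) ∧ ∃ x ∈ X, x ∉ S) :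
    (𝒞.card : ℤ) ≤ delta B := by
  set S' := (B ∪ 𝒞.biUnion id).filter (· ∈ S) with hS'
  have h1 := delta_union_add_card_le (S := S') 𝒞 hg hd (by
    intro X hX
    obtain ⟨⟨x, hx, hxS⟩, y, hy, hyS⟩ := hm X hX
    refine ⟨⟨x, Finset.mem_inter.2 ⟨hx, Finset.mem_filter.2
      ⟨Finset.mem_union_right _ (Finset.mem_biUnion.2 ⟨X, hX, hx⟩), hxS⟩⟩⟩, fun hsub => ?_⟩
    exact hyS (Finset.mem_filter.1 (hsub hy)).2)
  have h2 := hS.delta_le_of_mem_iff (A := S') (X := S' ∪ B ∪ 𝒞.biUnion id) fun x => by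
    simp only [hS', Finset.mem_filter, Finset.mem_union]
    tauto
  have h3 := delta_submodular S' B
  have e3 : S' ∩ B = B.filter (· ∈ S) := by
    ext x
    simp only [hS', Finset.mem_filter, Finset.mem_union, Finset.mem_inter]
    tauto
  rw [e3] at h3
  have h4 := hpos (B.filter (· ∈ S))
  linarith

/-- If all members of a family of good extensions of `B` have points on a common line through
`b ∈ B` and on a common line through another point `b' ∈ B`, each member after the first lowers
the predimension by two. -/
theorem delta_union_two_lines {B X₀ : Finset G} {b b' : G} (hb : b ∈ B) (hb' : b' ∈ B)
    (hbb : b ≠ b') (h₀ : IsGood B X₀) (𝒟 : Finset (Finset G))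
    (hg : ∀ X ∈ 𝒟, IsGood B X ∧ 2 ≤ X.card ∧ Disjoint X X₀ ∧
      (∃ c ∈ X, ∃ d ∈ X₀, R b c d) ∧ ∃ c ∈ X, ∃ d ∈ X₀, R b' c d)
    (hd : (𝒟 : Set (Finset G)).PairwiseDisjoint id) :
    delta (B ∪ X₀ ∪ 𝒟.biUnion id) + 2 * 𝒟.card ≤ delta B := by
  induction 𝒟 using Finset.induction_on with
  | empty => simp [h₀.delta_eq]
  | insert X 𝒟 hX ih =>
    have ih' := ih (fun Y hY => hg Y (Finset.mem_insert_of_mem hY)) (hd.subset (by simp))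
    obtain ⟨hgX, hcX, hdX₀, ⟨c, hc, d, hd', hR⟩, c', hc', d', hd'', hR'⟩ :=
      hg X (Finset.mem_insert_self _ _)
    have hdX := hgX.disjoint
    have hrest : ∀ x ∈ X, x ∉ B ∪ X₀ ∪ 𝒟.biUnion id := by
      intro x hx hx'
      rcases Finset.mem_union.1 hx' with hx' | hx'
      · rcases Finset.mem_union.1 hx' with hx' | hx'
        · exact Finset.disjoint_right.1 hdX hx hx'
        · exact Finset.disjoint_left.1 hdX₀ hx hx'
      · obtain ⟨Y, hY, hxY⟩ := Finset.mem_biUnion.1 hx'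
        have hne : X ≠ Y := fun e => hX (e ▸ hY)
        exact Finset.disjoint_left.1
          (hd (by simp) (by simp [hY]) hne : Disjoint X Y) hx hxY
    have eI : (B ∪ X₀ ∪ 𝒟.biUnion id) ∩ (B ∪ X) = B := by
      ext x
      have := hrest x
      simp only [Finset.mem_inter, Finset.mem_union] at this ⊢
      tauto
    have eU : (B ∪ X₀ ∪ 𝒟.biUnion id) ∪ (B ∪ X) = B ∪ X₀ ∪ (insert X 𝒟).biUnion id := by
      ext x
      simp only [Finset.biUnion_insert, Finset.mem_union, id]
      tauto
    have hX₀ : ∀ d ∈ X₀, d ∉ B ∪ X := by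
      intro d hd hd'
      rcases Finset.mem_union.1 hd' with hd' | hd'
      · exact Finset.disjoint_right.1 h₀.disjoint hd hd'
      · exact Finset.disjoint_left.1 hdX₀ hd' hd
    obtain ⟨L, hL, hbL, hcL, hdL, h3⟩ := exists_line_of_R
      (U := (B ∪ X₀ ∪ 𝒟.biUnion id) ∪ (B ∪ X)) hR (by simp [hb]) (by simp [hc]) (by simp [hd'])
    obtain ⟨L', hL', hbL', hcL', hdL', h3'⟩ := exists_line_of_R
      (U := (B ∪ X₀ ∪ 𝒟.biUnion id) ∪ (B ∪ X)) hR' (by simp [hb']) (by simp [hc'])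
      (by simp [hd''])
    have hLB := hgX.line_base hcX hL hc hcL
    have hLB' := hgX.line_base hcX hL' hc' hcL'
    have hLL : L ≠ L' := by
      rintro rfl
      exact hbb (Finset.card_le_one.1 hLB b (Finset.mem_inter.2 ⟨hbL, hb⟩) b'
        (Finset.mem_inter.2 ⟨hbL', hb'⟩))
    have := delta_add_card_le (A := B ∪ X₀ ∪ 𝒟.biUnion id) (B := B ∪ X) {L, L'} (by
      intro K hK
      rw [Finset.mem_insert, Finset.mem_singleton] at hK
      rcases hK with rfl | rfl
      · exact ⟨hL, ⟨c, hcL, hrest c hc⟩, ⟨d, hdL, hX₀ d hd'⟩, h3, by rw [eI]; exact hLB⟩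
      · exact ⟨hL', ⟨c', hcL', hrest c' hc'⟩, ⟨d', hdL', hX₀ d' hd''⟩, h3',
          by rw [eI]; exact hLB'⟩)
    rw [eI, eU, hgX.delta_eq, Finset.card_pair hLL] at this
    rw [Finset.card_insert_of_notMem hX]
    push_cast at this ⊢
    linarith

/-- Over a base that lies neither in `F` nor in `E`, a free amalgam with `E` primitive over `D`
contains at most `δ(B)` pairwise disjoint good extensions with at least two points. -/
theorem card_le_of_base_crosses (h : FreeAmalgam F E D)
    (hprim : ∀ X, D ⊂ X → X ⊆ E → Le X E → X = E) (hpos : ∀ X : Finset G, 0 ≤ delta X)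
    {B : Finset G} {𝒞 : Finset (Finset G)} (hg : ∀ X ∈ 𝒞, IsGood B X)
    (hd : (𝒞 : Set (Finset G)).PairwiseDisjoint id) (h2 : ∀ X ∈ 𝒞, 2 ≤ X.card)
    {b b' : G} (hb : b ∈ B) (hbF : b ∉ F) (hb' : b' ∈ B) (hb'E : b' ∉ E) :
    (𝒞.card : ℤ) ≤ delta B := by
  by_contra! hr
  have hbE : b ∈ E := (h.cover b).resolve_left hbF
  have hb'F : b' ∈ F := (h.cover b').resolve_right hb'E
  have hbb : b ≠ b' := fun e => hbF (e ▸ hb'F)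
  have hXE : ∀ X ∈ 𝒞, ∃ c ∈ X, ∃ c' ∈ X, R b c c' ∧ c ∈ E ∧ c' ∈ E := by
    intro X hX
    obtain ⟨c, hc, c', hc', hR⟩ := (hg X hX).exists_R₂ (h2 X hX) hb
    rcases h.free _ _ _ hR with h' | h'
    · exact absurd h'.1 hbF
    · exact ⟨c, hc, c', hc', hR, h'.2⟩
  have hXF : ∀ t ∈ B, t ∉ E → ∀ X ∈ 𝒞, ∃ c ∈ X, ∃ c' ∈ X, R t c c' ∧ c ∈ F ∧ c' ∈ F := by
    intro t ht htE X hX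
    obtain ⟨c, hc, c', hc', hR⟩ := (hg X hX).exists_R₂ (h2 X hX) ht
    rcases h.free _ _ _ hR with h' | h'
    · exact ⟨c, hc, c', hc', hR, h'.2⟩
    · exact absurd h'.1 htE
  -- unless some member lies in `F` and some member lies in `E`, one of the two strong
  -- substructures splits all members
  obtain ⟨X₁, hX₁, hX₁F⟩ : ∃ X ∈ 𝒞, ∀ x ∈ X, x ∈ F := by
    by_contra! hno
    have := card_le_of_split hpos h.strong_right hg hd (fun X hX => by
      obtain ⟨c, hc, -, -, -, hcF, -⟩ := hXF b' hb' hb'E X hX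
      exact ⟨⟨c, hc, hcF⟩, hno X hX⟩)
    linarith
  obtain ⟨X₂, hX₂, hX₂E⟩ : ∃ X ∈ 𝒞, ∀ x ∈ X, x ∈ E := by
    by_contra! hno
    have := card_le_of_split hpos h.strong_left hg hd (fun X hX => by
      obtain ⟨c, hc, -, -, -, hcE, -⟩ := hXE X hX
      exact ⟨⟨c, hc, hcE⟩, hno X hX⟩)
    linarith
  have hDE : D ⊆ E := fun x hx => ((h.mem_iff x).1 hx).1
  have hbD : b ∉ D := fun hx => hbF ((h.mem_iff b).1 hx).2
  have hb'D : b' ∉ D := fun hx => hb'E ((h.mem_iff b').1 hx).1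
  have hins : insert b D ⊆ E := Finset.insert_subset hbE hDE
  have hbδ : delta (insert b D) ≤ delta D := by
    obtain ⟨c, hc, c', hc', hR, hcE, hc'E⟩ := hXE X₁ hX₁
    exact delta_insert_le_of_R hbD ((h.mem_iff c).2 ⟨hcE, hX₁F c hc⟩)
      ((h.mem_iff c').2 ⟨hc'E, hX₁F c' hc'⟩) hR
  have hEeq : insert b D = E := hprim _ (Finset.ssubset_insert hbD) hins
    ⟨hins, fun Y hY hYE => hbδ.trans (h.le_left Y ((Finset.subset_insert _ _).trans hY) hYE)⟩
  -- all points of `B` outside `E` lie on lines of `D`, so no member is split by `E`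
  have hEB : delta (E ∪ B) ≤ delta E := delta_union_le_of_R fun t ht htE => by
    obtain ⟨c, hc, c', hc', hR, -⟩ := hXF t ht htE X₂ hX₂
    exact ⟨c, hX₂E c hc, c', hX₂E c' hc', hR⟩
  have hall : ∀ X ∈ 𝒞, X ⊆ E := by
    have h1 := delta_union_add_card_le (S := E) (𝒞.filter fun X => ¬ X ⊆ E)
      (fun X hX => hg X (Finset.mem_filter.1 hX).1)
      (hd.subset (Finset.coe_subset.2 (Finset.filter_subset _ _)))
      (fun X hX => by
        obtain ⟨c, hc, -, -, -, hcE, -⟩ := hXE X (Finset.mem_filter.1 hX).1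
        exact ⟨⟨c, Finset.mem_inter.2 ⟨hc, hcE⟩⟩, (Finset.mem_filter.1 hX).2⟩)
    have h2 := h.strong_left.delta_le_of_mem_iff (A := E)
      (X := E ∪ B ∪ (𝒞.filter fun X => ¬ X ⊆ E).biUnion id) fun x => by
        simp only [Finset.mem_union, Finset.mem_coe]
        tauto
    have h3 : (𝒞.filter fun X => ¬ X ⊆ E).card = 0 := by
      have : ((𝒞.filter fun X => ¬ X ⊆ E).card : ℤ) ≤ 0 := by linarith
      exact_mod_cast le_antisymm this (by positivity)
    intro X hX
    by_contra hXn
    exact Finset.notMem_empty X (Finset.card_eq_zero.1 h3 ▸ Finset.mem_filter.2 ⟨hX, hXn⟩)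
  have hallD : ∀ X ∈ 𝒞, ∀ x ∈ X, x ∈ D := by
    intro X hX x hx
    have := hall X hX hx
    rw [← hEeq, Finset.mem_insert] at this
    refine this.resolve_left fun e => ?_
    subst e
    exact Finset.disjoint_left.1 (hg X hX).disjoint hb hx
  have hne : ∀ X ∈ 𝒞, X ≠ X₁ → Disjoint X X₁ := fun X hX hne => hd hX hX₁ hne
  have hline : ∀ t : G, t ∉ D → delta D ≤ delta (insert t D) →
      (∀ X ∈ 𝒞, ∃ c ∈ X, ∃ c' ∈ X, R t c c') →
      ∀ X ∈ 𝒞, X ≠ X₁ → ∃ c ∈ X, ∃ d ∈ X₁, R t c d := by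
    intro t htD htδ hR X hX hXX
    obtain ⟨c, hc, c', hc', h1⟩ := hR X hX
    obtain ⟨d, hd, d', hd', h2⟩ := hR X₁ hX₁
    refine ⟨c, hc, d, hd, R_of_delta_le_insert htD (hallD X hX c hc) (hallD X hX c' hc')
      (hallD X₁ hX₁ d hd) (hallD X₁ hX₁ d' hd') h1 h2 htδ fun e => ?_⟩
    exact Finset.disjoint_left.1 (hne X hX hXX) hc (e ▸ hd)
  have hlb := hline b hbD (h.le_left _ (Finset.subset_insert _ _) hins) fun X hX => by
    obtain ⟨c, hc, c', hc', hR, -⟩ := hXE X hX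
    exact ⟨c, hc, c', hc', hR⟩
  have hlb' := hline b' hb'D (h.le_right _ (Finset.subset_insert _ _) (by
      intro x hx
      rcases Finset.mem_insert.1 (Finset.mem_coe.1 hx) with rfl | hx
      · exact hb'F
      · exact ((h.mem_iff x).1 hx).2)) fun X hX => by
    obtain ⟨c, hc, c', hc', hR, -⟩ := hXF b' hb' hb'E X hX
    exact ⟨c, hc, c', hc', hR⟩
  have hfin := delta_union_two_lines hb hb' hbb (hg X₁ hX₁) (𝒞.erase X₁) (by
    intro X hX
    obtain ⟨hXX, hX⟩ := Finset.mem_erase.1 hX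
    exact ⟨hg X hX, h2 X hX, hne X hX hXX, hlb X hX hXX, hlb' X hX hXX⟩)
    (hd.subset (Finset.coe_subset.2 (Finset.erase_subset _ _)))
  have h0 := hpos (B ∪ X₁ ∪ (𝒞.erase X₁).biUnion id)
  have hcard := Finset.card_erase_add_one hX₁
  have hBpos : 1 ≤ delta B := by
    have h1 := h.strong_right.delta_le_of_mem_iff (A := B.filter (· ∈ F) ∪ X₁)
      (X := B ∪ X₁) fun x => by
        have := hX₁F x
        simp only [Finset.mem_filter, Finset.mem_union]
        tauto
    have h3 := (hg X₁ hX₁).lt_of_base (B' := B.filter (· ∈ F))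
      ⟨Finset.filter_subset _ _, fun hsub => hbF (Finset.mem_filter.1 (hsub hb)).2⟩
    have h4 := hpos (B.filter (· ∈ F))
    rw [(hg X₁ hX₁).delta_eq] at h1
    linarith
  have : ((𝒞.erase X₁).card : ℤ) + 1 = 𝒞.card := by exact_mod_cast hcard
  linarith

/-- A free amalgam of `F` and `E` over `D`, with `E` primitive over `D`, satisfies the
multiplicity bounds unless `F` already contains a copy of `E` over `D`. -/
theorem boundedIn_or_exists_copy {μ : GoodPair → ℕ} (hμ : InU μ) (h : FreeAmalgam F E D)
    (hprim : ∀ X, D ⊂ X → X ⊆ E → Le X E → X = E)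
    (hF : BoundedIn μ F) (hE : BoundedIn μ (E : Set G)) :
    BoundedIn μ (Set.univ : Set G) ∨ (delta E = delta D ∧ ∃ k : G → G, (∀ x ∈ D, k x = x) ∧
      (∀ x ∈ E, k x ∈ F) ∧ Set.InjOn k E ∧
      ∀ x ∈ E, ∀ y ∈ E, ∀ z ∈ E, R (k x) (k y) (k z) ↔ R x y z) := by
  have hpos : ∀ X : Finset G, 0 ≤ delta X := fun X =>
    (hF.1 (X.filter (· ∈ F)) (by intro x hx; exact (Finset.mem_filter.1 hx).2)).trans
      (isStrong_iff.1 h.strong_right X)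
  refine or_iff_not_imp_right.2 fun hno => ⟨fun A _ => hpos A, ?_⟩
  intro P e 𝒞 _ hC hd
  by_contra! hr
  have hC' : ∀ X ∈ 𝒞, IsCopy P e X := fun X hX => (hC X hX).1
  clear hC
  set B : Finset G := Finset.univ.map e.emb with hBdef
  have hg : ∀ X ∈ 𝒞, IsGood B X := fun X hX => (hC' X hX).isGood
  have heB : ∀ b, e.toFun b ∈ B := fun b => Finset.mem_map_of_mem e.emb (Finset.mem_univ b)
  have hDE : D ⊆ E := fun x hx => ((h.mem_iff x).1 hx).1
  -- families inside `F` or inside `E` respect the bound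
  have hnF : (∀ b ∈ B, b ∈ F) → ∃ X ∈ 𝒞, ¬ (X : Set G) ⊆ F := by
    intro hBF
    by_contra! hall
    exact absurd (hF.2 P e 𝒞 (fun b => hBF _ (heB b)) (fun X hX => ⟨hC' X hX, hall X hX⟩) hd)
      (by omega)
  have hnE : (∀ b ∈ B, b ∈ E) → ∃ X ∈ 𝒞, ¬ (X : Set G) ⊆ (E : Set G) := by
    intro hBE
    by_contra! hall
    exact absurd (hE.2 P e 𝒞 (fun b => hBE _ (heB b)) (fun X hX => ⟨hC' X hX, hall X hX⟩) hd)
      (by omega)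
  by_cases hBF : ∀ b ∈ B, b ∈ F
  · obtain ⟨X₀, hX₀, hX₀n⟩ := hnF hBF
    have hX₀F := ((hg X₀ hX₀).subset_or_disjoint h.strong_right hBF).resolve_left hX₀n
    have hX₀E : ∀ x ∈ X₀, x ∈ E := fun x hx => (h.cover x).resolve_left (hX₀F x hx)
    have hBD : B ⊆ D := by
      intro b hb
      obtain ⟨c, hc, x, -, hR⟩ := (hg X₀ hX₀).exists_R hb
      rcases h.free _ _ _ hR with h' | h'
      · exact absurd h'.2.1 (hX₀F c hc)
      · exact (h.mem_iff b).2 ⟨h'.1, hBF b hb⟩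
    have hDX₀ : Disjoint D X₀ := Finset.disjoint_left.2 fun x hx hx' =>
      hX₀F x hx' ((h.mem_iff x).1 hx).2
    have hDX₀δ : delta (D ∪ X₀) ≤ delta D := by
      have h1 := delta_submodular D (B ∪ X₀)
      have e1 : D ∪ (B ∪ X₀) = D ∪ X₀ := by
        rw [← Finset.union_assoc, Finset.union_eq_left.2 hBD]
      have e2 : D ∩ (B ∪ X₀) = B := by
        rw [Finset.inter_union_distrib_left, Finset.inter_eq_right.2 hBD,
          Finset.disjoint_iff_inter_eq_empty.1 hDX₀, Finset.union_empty]
      rw [e1, e2, (hg X₀ hX₀).delta_eq] at h1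
      linarith
    have hsubE : D ∪ X₀ ⊆ E := Finset.union_subset hDE hX₀E
    have hEeq : D ∪ X₀ = E := by
      refine hprim _ ⟨Finset.subset_union_left, fun hsub => ?_⟩ hsubE ⟨hsubE, fun Y hY hYE =>
        hDX₀δ.trans (h.le_left Y (Finset.subset_union_left.trans hY) hYE)⟩
      obtain ⟨x, hx⟩ := (hg X₀ hX₀).nonempty
      exact Finset.disjoint_right.1 hDX₀ hx (hsub (Finset.mem_union_right _ hx))
    have hEδ : delta E = delta D := le_antisymm (hEeq ▸ hDX₀δ) (h.le_left E hDE subset_rfl)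
    obtain ⟨X₁, hX₁, hX₁n⟩ := hnE fun b hb => hDE (hBD hb)
    have hX₁E : ∀ x ∈ X₁, x ∉ E := by
      have := ((hg X₁ hX₁).subset_or_disjoint h.strong_left
        (fun b hb => hDE (hBD hb))).resolve_left hX₁n
      exact this
    have hX₁F : ∀ x ∈ X₁, x ∈ F := fun x hx => (h.cover x).resolve_right (hX₁E x hx)
    have hDX₁ : Disjoint D X₁ := Finset.disjoint_left.2 fun x hx hx' => hX₁E x hx' (hDE hx)
    obtain ⟨φ, hφB, hφX, hφi, hφR⟩ := (hC' X₀ hX₀).exists_iso (hC' X₁ hX₁)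
    rw [← hBdef] at hφB hφR
    by_cases hc2 : 2 ≤ X₀.card
    · have hc2' : 2 ≤ X₁.card := by
        rw [(hC' X₁ hX₁).card_eq, ← (hC' X₀ hX₀).card_eq]
        exact hc2
      have hδ₀ : delta D ≤ delta (D ∪ X₀) := h.le_left _ Finset.subset_union_left hsubE
      have hδ₁ : delta D ≤ delta (D ∪ X₁) := h.le_right _ Finset.subset_union_left (by
        intro x hx
        rcases Finset.mem_union.1 (Finset.mem_coe.1 hx) with hx | hx
        · exact ((h.mem_iff x).1 hx).2
        · exact hX₁F x hx)
      let k : G → G := fun x => if x ∈ X₀ then φ x else x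
      have hk₀ : ∀ x ∈ X₀, k x = φ x := fun x hx => if_pos hx
      have hk : ∀ x ∈ D, k x = x := fun x hx => if_neg (Finset.disjoint_left.1 hDX₀ hx)
      have hkB : ∀ x ∈ B ∪ X₀, k x = φ x := by
        intro x hx
        rcases Finset.mem_union.1 hx with hx | hx
        · rw [hk x (hBD hx), hφB x hx]
        · exact hk₀ x hx
      have hkU : ∀ x ∈ D ∪ X₀, k x ∈ D ∪ X₁ := by
        intro x hx
        rcases Finset.mem_union.1 hx with hx | hx
        · rw [hk x hx]
          exact Finset.mem_union_left _ hx
        · rw [hk₀ x hx]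
          exact Finset.mem_union_right _ (hφX x hx)
      have hkn : ∀ x ∈ D ∪ X₀, k x ∈ B ∪ X₁ → x ∈ B ∪ X₀ := by
        intro x hx hkx
        rcases Finset.mem_union.1 hx with hx | hx
        · rw [hk x hx] at hkx
          exact Finset.mem_union_left _ ((Finset.mem_union.1 hkx).resolve_right
            (Finset.disjoint_left.1 hDX₁ hx))
        · exact Finset.mem_union_right _ hx
      -- the triples that involve a point of `X₀`
      have key : ∀ x ∈ X₀, ∀ y ∈ D ∪ X₀, ∀ z ∈ D ∪ X₀,
          (R (k x) (k y) (k z) ↔ R x y z) := by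
        intro x hx y hy z hz
        have hx' : x ∈ B ∪ X₀ := Finset.mem_union_right _ hx
        by_cases hyz : y ∈ B ∪ X₀ ∧ z ∈ B ∪ X₀
        · rw [hkB x hx', hkB y hyz.1, hkB z hyz.2]
          exact hφR x hx' y hyz.1 z hyz.2
        · refine iff_of_false (fun hR => hyz ⟨?_, ?_⟩) (fun hR => hyz ⟨?_, ?_⟩)
          · exact hkn y hy ((hg X₁ hX₁).mem_of_R hc2' hBD hDX₁ hδ₁ (hk₀ x hx ▸ hφX x hx)
              (hkU y hy) (hkU z hz) hR)
          · exact hkn z hz ((hg X₁ hX₁).mem_of_R hc2' hBD hDX₁ hδ₁ (hk₀ x hx ▸ hφX x hx)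
              (hkU z hz) (hkU y hy) (swap (rot (rot hR))))
          · exact (hg X₀ hX₀).mem_of_R hc2 hBD hDX₀ hδ₀ hx hy hz hR
          · exact (hg X₀ hX₀).mem_of_R hc2 hBD hDX₀ hδ₀ hx hz hy (swap (rot (rot hR)))
      refine hno ⟨hEδ, k, hk, ?_, ?_, ?_⟩
      · intro x hx
        rw [← hEeq] at hx
        rcases Finset.mem_union.1 (hkU x hx) with h' | h'
        · exact ((h.mem_iff _).1 h').2
        · exact hX₁F _ h'
      · intro x hx y hy hxy
        rw [← hEeq] at hx hy
        rcases Finset.mem_union.1 (Finset.mem_coe.1 hx) with hx | hx <;>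
          rcases Finset.mem_union.1 (Finset.mem_coe.1 hy) with hy | hy
        · rwa [hk x hx, hk y hy] at hxy
        · rw [hk x hx, hk₀ y hy] at hxy
          exact absurd (hxy ▸ hφX y hy) (Finset.disjoint_left.1 hDX₁ hx)
        · rw [hk₀ x hx, hk y hy] at hxy
          exact absurd (hxy ▸ hφX x hx) (Finset.disjoint_left.1 hDX₁ hy)
        · rw [hk₀ x hx, hk₀ y hy] at hxy
          exact hφi hx hy hxy
      · intro x hx y hy z hz
        rw [← hEeq] at hx hy hz
        by_cases hx₀ : x ∈ X₀
        · exact key x hx₀ y hy z hz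
        by_cases hy₀ : y ∈ X₀
        · exact ⟨fun hR => swap ((key y hy₀ x hx z hz).1 (swap hR)),
            fun hR => swap ((key y hy₀ x hx z hz).2 (swap hR))⟩
        by_cases hz₀ : z ∈ X₀
        · exact ⟨fun hR => rot ((key z hz₀ x hx y hy).1 (rot (rot hR))),
            fun hR => rot ((key z hz₀ x hx y hy).2 (rot (rot hR)))⟩
        rw [hk x ((Finset.mem_union.1 hx).resolve_right hx₀),
          hk y ((Finset.mem_union.1 hy).resolve_right hy₀),
          hk z ((Finset.mem_union.1 hz).resolve_right hz₀)]
    · -- a single new point would put a point of `E ∖ F` and a point of `F ∖ E` on one line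
      obtain ⟨c, hcX₀⟩ := Finset.card_eq_one.1 (by
        have := (hg X₀ hX₀).nonempty.card_pos
        omega : X₀.card = 1)
      have hc : c ∈ X₀ := by simp [hcX₀]
      have hcB : c ∉ B := Finset.disjoint_right.1 (hg X₀ hX₀).disjoint hc
      obtain ⟨x, hx, y, hy, hR⟩ : ∃ x ∈ B, ∃ y ∈ B, R c x y := by
        by_contra! hnR
        have h1 := delta_insert_of_not_R hcB hnR
        have h2 := (hg X₀ hX₀).delta_eq
        rw [hcX₀, Finset.union_comm, ← Finset.insert_eq] at h2
        linarith
      have hR' := (hφR c (Finset.mem_union_right _ hc) x (Finset.mem_union_left _ hx) y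
        (Finset.mem_union_left _ hy)).2 hR
      rw [hφB x hx, hφB y hy] at hR'
      have hne : c ≠ φ c := fun e' => hX₁E _ (hφX c hc) (e' ▸ hX₀E c hc)
      rcases h.free _ _ _ (line (rot hR) (rot hR') hne) with h' | h'
      · exact hX₀F c hc h'.2.2
      · exact hX₁E _ (hφX c hc) h'.2.1
  · push Not at hBF
    obtain ⟨b, hb, hbF⟩ := hBF
    by_cases hBE : ∀ b ∈ B, b ∈ E
    · obtain ⟨X, hX, hXn⟩ := hnE hBE
      have hXE := ((hg X hX).subset_or_disjoint h.strong_left hBE).resolve_left hXn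
      obtain ⟨c, hc, x, -, hR⟩ := (hg X hX).exists_R hb
      rcases h.free _ _ _ hR with h' | h'
      · exact hbF h'.1
      · exact hXE c hc h'.2.1
    push Not at hBE
    obtain ⟨b', hb', hb'E⟩ := hBE
    obtain ⟨X, hX⟩ : 𝒞.Nonempty := Finset.card_pos.1 (by omega)
    by_cases hc2 : 2 ≤ P.baseᶜ.card
    · have h1 := h.card_le_of_base_crosses hprim hpos hg hd
        (fun X hX => by rw [(hC' X hX).card_eq]; exact hc2) hb hbF hb' hb'E
      have h2 := hμ.base_le P hc2
      rw [(hC' X hX).delta_base] at h1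
      have : (μ P : ℤ) < 𝒞.card := by exact_mod_cast hr
      linarith
    · -- the base of a one-point good pair consists of two points on a line with that point
      obtain ⟨c, hcX⟩ := Finset.card_eq_one.1 (by
        have := (hg X hX).nonempty.card_pos
        rw [(hC' X hX).card_eq] at this ⊢
        omega : X.card = 1)
      have hc : c ∈ X := by simp [hcX]
      have hcB : c ∉ B := Finset.disjoint_right.1 (hg X hX).disjoint hc
      obtain ⟨c', hc', x, hx, hR⟩ := (hg X hX).exists_R hb
      obtain rfl : c' = c := by simpa [hcX] using hc'
      have hxB : x ∈ B := by
        refine (Finset.mem_union.1 hx).resolve_right fun hxX => ?_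
        rw [hcX, Finset.mem_singleton] at hxX
        exact ne₂₃ hR hxX.symm
      have hsub : ({b, x} : Finset G) ⊆ B := by
        intro y hy
        rw [Finset.mem_insert, Finset.mem_singleton] at hy
        rcases hy with rfl | rfl <;> assumption
      have hBeq : ({b, x} : Finset G) = B := by
        by_contra hne
        have h1 := (hg X hX).lt_of_base (hsub.ssubset_of_ne hne)
        have h2 := delta_insert_le_of_R (S := {b, x}) (fun hcm => hcB (hsub hcm))
          (by simp) (by simp) (swap hR)
        rw [hcX, Finset.union_comm, ← Finset.insert_eq] at h1
        linarith
      rcases h.free _ _ _ hR with h' | h'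
      · exact hbF h'.1
      · rw [← hBeq, Finset.mem_insert, Finset.mem_singleton] at hb'
        rcases hb' with rfl | rfl
        · exact hb'E h'.1
        · exact hb'E h'.2.2

end FreeAmalgam

end FreeAmalgam

end CollSpace

namespace CollSpace

section Gluing

open Classical

/-! ### Gluing two structures -/

variable {D : Type w} {E : Type v} {F : Type u} [CollSpace D] [CollSpace E] [CollSpace F]

/-- The union of the relations of `E` and `F` on a type `G` that is covered by images of `E` and
`F` meeting in `D`. It is a linear space if no line of `D` gets new points from both sides. -/
@[reducible]
def glue {G : Type*} (f : Emb D F) (g : Emb D E) (i : F → G) (j : E → G)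
    (hi : Function.Injective i) (hj : Function.Injective j)
    (hij : ∀ y z, j y = i z → ∃ d, y = g.toFun d ∧ z = f.toFun d)
    (hcomm : ∀ d, j (g.toFun d) = i (f.toFun d))
    (hno : ∀ a b z y, R (f.toFun a) (f.toFun b) z → R (g.toFun a) (g.toFun b) y →
      z ∈ Set.range f.toFun ∨ y ∈ Set.range g.toFun) : CollSpace G where
  R x y z := (∃ a b c, i a = x ∧ i b = y ∧ i c = z ∧ R a b c) ∨
    ∃ a b c, j a = x ∧ j b = y ∧ j c = z ∧ R a b c
  ne₁₂ := by
    rintro _ _ _ (⟨a, b, c, rfl, rfl, rfl, h⟩ | ⟨a, b, c, rfl, rfl, rfl, h⟩)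
    · exact hi.ne (ne₁₂ h)
    · exact hj.ne (ne₁₂ h)
  ne₁₃ := by
    rintro _ _ _ (⟨a, b, c, rfl, rfl, rfl, h⟩ | ⟨a, b, c, rfl, rfl, rfl, h⟩)
    · exact hi.ne (ne₁₃ h)
    · exact hj.ne (ne₁₃ h)
  ne₂₃ := by
    rintro _ _ _ (⟨a, b, c, rfl, rfl, rfl, h⟩ | ⟨a, b, c, rfl, rfl, rfl, h⟩)
    · exact hi.ne (ne₂₃ h)
    · exact hj.ne (ne₂₃ h)
  swap := by
    rintro _ _ _ (⟨a, b, c, rfl, rfl, rfl, h⟩ | ⟨a, b, c, rfl, rfl, rfl, h⟩)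
    · exact Or.inl ⟨b, a, c, rfl, rfl, rfl, CollSpace.swap h⟩
    · exact Or.inr ⟨b, a, c, rfl, rfl, rfl, CollSpace.swap h⟩
  rot := by
    rintro _ _ _ (⟨a, b, c, rfl, rfl, rfl, h⟩ | ⟨a, b, c, rfl, rfl, rfl, h⟩)
    · exact Or.inl ⟨b, c, a, rfl, rfl, rfl, CollSpace.rot h⟩
    · exact Or.inr ⟨b, c, a, rfl, rfl, rfl, CollSpace.rot h⟩
  line := by
    -- a triple from `F` and a triple from `E` that share two points
    have mixed : ∀ (a b c : F) (a' b' c' : E), j a' = i a → j b' = i b → i c ≠ j c' →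
        R a b c → R a' b' c' → (∃ t : F, i t = j c' ∧ R a t c) ∨ ∃ t : E, j t = i c ∧
          R a' c' t := by
      intro a b c a' b' c' ha hb hne h h'
      obtain ⟨d₁, rfl, rfl⟩ := hij _ _ ha
      obtain ⟨d₂, rfl, rfl⟩ := hij _ _ hb
      rcases hno _ _ _ _ h h' with ⟨d, rfl⟩ | ⟨d, rfl⟩
      · refine Or.inr ⟨g.toFun d, hcomm d, CollSpace.line ?_ h' fun e => hne ?_⟩
        · rwa [g.map_R, ← f.map_R]
        · rw [← hcomm, e]
      · refine Or.inl ⟨f.toFun d, (hcomm d).symm, CollSpace.line h ?_ fun e => hne ?_⟩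
        · rwa [f.map_R, ← g.map_R]
        · rw [e, hcomm]
    rintro x y z w h h' hne
    rcases h with ⟨a, b, c, rfl, rfl, rfl, h⟩ | ⟨a, b, c, rfl, rfl, rfl, h⟩ <;>
      rcases h' with ⟨a', b', c', ha, hb, rfl, h'⟩ | ⟨a', b', c', ha, hb, rfl, h'⟩
    · obtain rfl := hi ha
      obtain rfl := hi hb
      exact Or.inl ⟨_, _, _, rfl, rfl, rfl, CollSpace.line h h' fun e => hne (by rw [e])⟩
    · rcases mixed a b c a' b' c' ha hb hne h h' with ⟨t, ht, hR⟩ | ⟨t, ht, hR⟩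
      · exact Or.inl ⟨a, t, c, rfl, ht, rfl, hR⟩
      · exact Or.inr ⟨a', c', t, ha, rfl, ht, hR⟩
    · rcases mixed a' b' c' a b c ha.symm hb.symm hne.symm h' h with ⟨t, ht, hR⟩ | ⟨t, ht, hR⟩
      · exact Or.inl ⟨a', c', t, ha, rfl, ht, CollSpace.swap (CollSpace.rot (CollSpace.rot hR))⟩
      · exact Or.inr ⟨a, t, c, rfl, ht, rfl, CollSpace.swap (CollSpace.rot (CollSpace.rot hR))⟩
    · obtain rfl := hj ha
      obtain rfl := hj hb
      exact Or.inr ⟨_, _, _, rfl, rfl, rfl, CollSpace.line h h' fun e => hne (by rw [e])⟩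

/-- The disjoint union over `D`: a linear space on which `E` and `F` embed with exactly the
triples of `E` and of `F`. The new points are taken from a copy `E₀` of `E` in the lowest universe,
so that the result lies in the universe of `F`. -/
theorem exists_glue (f : Emb D F) (g : Emb D E)
    (hno : ∀ a b z y, R (f.toFun a) (f.toFun b) z → R (g.toFun a) (g.toFun b) y →
      z ∈ Set.range f.toFun ∨ y ∈ Set.range g.toFun)
    {E₀ : Type} (ε : E ≃ E₀) :
    ∃ (G : Type u) (_ : CollSpace G) (i : Emb F G) (j : Emb E G),
      (∀ d, j.toFun (g.toFun d) = i.toFun (f.toFun d)) ∧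
      (∀ y z, j.toFun y = i.toFun z → ∃ d, y = g.toFun d ∧ z = f.toFun d) ∧
      (∀ x, x ∈ Set.range i.toFun ∨ x ∈ Set.range j.toFun) ∧
      ∀ x y z : G, R x y z →
        (x ∈ Set.range i.toFun ∧ y ∈ Set.range i.toFun ∧ z ∈ Set.range i.toFun) ∨
        (x ∈ Set.range j.toFun ∧ y ∈ Set.range j.toFun ∧ z ∈ Set.range j.toFun) := by
  let j : E → F ⊕ {y : E₀ // ε.symm y ∉ Set.range g.toFun} := fun y =>
    if h : y ∈ Set.range g.toFun then Sum.inl (f.toFun h.choose)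
    else Sum.inr ⟨ε y, by rwa [Equiv.symm_apply_apply]⟩
  have hjg : ∀ d, j (g.toFun d) = Sum.inl (f.toFun d) := by
    intro d
    have h : g.toFun d ∈ Set.range g.toFun := ⟨d, rfl⟩
    have := g.inj h.choose_spec
    simp only [j, dif_pos h, this]
  have hjn : ∀ y (h : y ∉ Set.range g.toFun),
      j y = Sum.inr ⟨ε y, by rwa [Equiv.symm_apply_apply]⟩ := fun y h => dif_neg h
  have hij : ∀ y z, j y = Sum.inl z → ∃ d, y = g.toFun d ∧ z = f.toFun d := by
    intro y z h
    by_cases hy : y ∈ Set.range g.toFun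
    · obtain ⟨d, rfl⟩ := hy
      rw [hjg, Sum.inl.injEq] at h
      exact ⟨d, rfl, h.symm⟩
    · rw [hjn y hy] at h
      cases h
  have hj : Function.Injective j := by
    intro y y' h
    by_cases hy : y' ∈ Set.range g.toFun
    · obtain ⟨d', rfl⟩ := hy
      rw [hjg] at h
      obtain ⟨d, rfl, hd⟩ := hij _ _ h
      rw [f.inj hd]
    · by_cases hy' : y ∈ Set.range g.toFun
      · obtain ⟨d', rfl⟩ := hy'
        rw [hjg, hjn y' hy] at h
        cases h
      · rw [hjn y hy', hjn y' hy, Sum.inr.injEq, Subtype.mk.injEq] at h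
        exact ε.injective h
  let _ := glue f g (Sum.inl : F → F ⊕ {y : E₀ // ε.symm y ∉ Set.range g.toFun}) j
    Sum.inl_injective hj hij hjg hno
  refine ⟨F ⊕ {y : E₀ // ε.symm y ∉ Set.range g.toFun}, inferInstance,
    ⟨Sum.inl, Sum.inl_injective, fun a b c => ⟨?_, ?_⟩⟩, ⟨j, hj, fun a b c => ⟨?_, ?_⟩⟩,
    hjg, hij, ?_, ?_⟩
  · rintro (⟨a', b', c', ha, hb, hc, h⟩ | ⟨a', b', c', ha, hb, hc, h⟩)
    · rwa [← Sum.inl_injective ha, ← Sum.inl_injective hb, ← Sum.inl_injective hc]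
    · obtain ⟨a, rfl, rfl⟩ := hij _ _ ha
      obtain ⟨b, rfl, rfl⟩ := hij _ _ hb
      obtain ⟨c, rfl, rfl⟩ := hij _ _ hc
      rwa [f.map_R, ← g.map_R]
  · exact fun h => Or.inl ⟨a, b, c, rfl, rfl, rfl, h⟩
  · rintro (⟨a', b', c', ha, hb, hc, h⟩ | ⟨a', b', c', ha, hb, hc, h⟩)
    · obtain ⟨a, rfl, rfl⟩ := hij _ _ ha.symm
      obtain ⟨b, rfl, rfl⟩ := hij _ _ hb.symm
      obtain ⟨c, rfl, rfl⟩ := hij _ _ hc.symm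
      rwa [g.map_R, ← f.map_R]
    · rwa [← hj ha, ← hj hb, ← hj hc]
  · exact fun h => Or.inr ⟨a, b, c, rfl, rfl, rfl, h⟩
  · rintro (x | ⟨x, hx⟩)
    · exact Or.inl ⟨x, rfl⟩
    · refine Or.inr ⟨ε.symm x, ?_⟩
      exact (hjn _ hx).trans (by simp)
  · rintro _ _ _ (⟨a, b, c, rfl, rfl, rfl, -⟩ | ⟨a, b, c, rfl, rfl, rfl, -⟩)
    · exact Or.inl ⟨⟨a, rfl⟩, ⟨b, rfl⟩, ⟨c, rfl⟩⟩
    · exact Or.inr ⟨⟨a, rfl⟩, ⟨b, rfl⟩, ⟨c, rfl⟩⟩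

/-! ### Primitive extensions -/

/-- No proper strong substructure of `E` properly contains the image of `D`. -/
def PrimitiveEmb (g : Emb D E) : Prop :=
  ∀ X : Finset E, (∀ d, g.toFun d ∈ X) → (∃ x ∈ X, x ∉ Set.range g.toFun) →
    IsStrong (X : Set E) → ∀ x, x ∈ X

/-- An extension of a strong embedding of `D` to a set `E` of no larger predimension is strong. -/
theorem Emb.isStrong_of_extends [Fintype D] [Fintype E] (f : StrongEmb D F) (g : Emb D E)
    (k : Emb E F) (hk : ∀ d, k.toFun (g.toFun d) = f.toFun d)
    (hδ : delta (Finset.univ : Finset E) ≤ delta (Finset.univ : Finset D)) :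
    IsStrong (Set.range k.toFun) := by
  refine k.isStrong_of_delta_le fun X hX => hδ.trans (f.delta_le ?_)
  intro x hx
  obtain ⟨d, -, rfl⟩ := Finset.mem_map.1 hx
  rw [Emb.emb_apply, ← hk]
  exact hX (Finset.mem_map_of_mem k.emb (Finset.mem_univ _))

/-- An embedding of `D` extends to a one-point extension `D ∪ {w}` by a point `z` with the same
collinearities over `D` as `w`. -/
theorem Emb.exists_extend_point (f : Emb D F) (g : Emb D E) {w : E} {z : F}
    (hE : ∀ y, y ∈ Set.range g.toFun ∨ y = w) (hw : w ∉ Set.range g.toFun)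
    (hz : z ∉ Set.range f.toFun)
    (hR : ∀ a b, R z (f.toFun a) (f.toFun b) ↔ R w (g.toFun a) (g.toFun b)) :
    ∃ k : Emb E F, (∀ d, k.toFun (g.toFun d) = f.toFun d) ∧ k.toFun w = z := by
  set k : E → F := Function.extend g.toFun f.toFun fun _ => z with hk
  have hkg : ∀ d, k (g.toFun d) = f.toFun d := fun d => g.inj.extend_apply _ _ _
  have hkw : k w = z := Function.extend_apply' _ _ _ hw
  have hwR : ∀ y t, R (k w) (k y) (k t) ↔ R w y t := by
    intro y t
    rcases hE y with ⟨a, rfl⟩ | rfl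
    · rcases hE t with ⟨b, rfl⟩ | rfl
      · rw [hkw, hkg, hkg]
        exact hR a b
      · exact iff_of_false (fun h => ne₁₃ h rfl) (fun h => ne₁₃ h rfl)
    · exact iff_of_false (fun h => ne₁₂ h rfl) (fun h => ne₁₂ h rfl)
  refine ⟨⟨k, ?_, ?_⟩, hkg, hkw⟩
  · intro y t h
    rcases hE y with ⟨a, rfl⟩ | rfl <;> rcases hE t with ⟨b, rfl⟩ | rfl
    · rw [hkg, hkg] at h
      rw [f.inj h]
    · rw [hkg, hkw] at h
      exact absurd ⟨a, h⟩ hz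
    · rw [hkg, hkw] at h
      exact absurd ⟨b, h.symm⟩ hz
    · rfl
  · intro x y t
    rcases hE x with ⟨a, rfl⟩ | rfl
    · rcases hE y with ⟨b, rfl⟩ | rfl
      · rcases hE t with ⟨c, rfl⟩ | rfl
        · rw [hkg, hkg, hkg, f.map_R, g.map_R]
        · exact ⟨fun h => rot ((hwR _ _).1 (rot (rot h))), fun h => rot ((hwR _ _).2 (rot (rot h)))⟩
      · exact ⟨fun h => swap ((hwR _ _).1 (swap h)), fun h => swap ((hwR _ _).2 (swap h))⟩
    · exact hwR y t

theorem Emb.col_iff (f : Emb D F) {a b c : D} :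
    Col (f.toFun a) (f.toFun b) (f.toFun c) ↔ Col a b c := by
  unfold Col
  rw [f.inj.eq_iff, f.inj.eq_iff, f.map_R]

/-- A strong embedding maps `D` to a set of least predimension among its supersets. -/
theorem StrongEmb.delta_map_le [Fintype D] (f : StrongEmb D F) {X : Finset F}
    (hX : (Finset.univ : Finset D).map f.toEmb.emb ⊆ X) :
    delta ((Finset.univ : Finset D).map f.toEmb.emb) ≤ delta X := by
  rw [delta_map]
  exact f.delta_le hX

/-- If `E` is primitive over `D` and adds a point to a line of `D` to which `F` adds a point as
well, then `E` embeds strongly into `F` over `D`. -/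
theorem PrimitiveEmb.exists_strongEmb_of_conflict [Fintype D] [Fintype E] {f : StrongEmb D F}
    {g : StrongEmb D E} (hprim : PrimitiveEmb g.toEmb) {a b : D} {z : F} {w : E}
    (hz : R (f.toFun a) (f.toFun b) z) (hzf : z ∉ Set.range f.toFun)
    (hw : R (g.toFun a) (g.toFun b) w) (hwg : w ∉ Set.range g.toFun) :
    ∃ k : StrongEmb E F, ∀ d, k.toFun (g.toFun d) = f.toFun d := by
  have hmf : ∀ d, f.toFun d ∈ (Finset.univ : Finset D).map f.toEmb.emb :=
    fun d => Finset.mem_map_of_mem f.toEmb.emb (Finset.mem_univ d)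
  have hmg : ∀ d, g.toFun d ∈ (Finset.univ : Finset D).map g.toEmb.emb :=
    fun d => Finset.mem_map_of_mem g.toEmb.emb (Finset.mem_univ d)
  have hzn : z ∉ (Finset.univ : Finset D).map f.toEmb.emb := fun h => hzf (by
    obtain ⟨d, -, rfl⟩ := Finset.mem_map.1 h
    exact ⟨d, rfl⟩)
  have hwn : w ∉ (Finset.univ : Finset D).map g.toEmb.emb := fun h => hwg (by
    obtain ⟨d, -, rfl⟩ := Finset.mem_map.1 h
    exact ⟨d, rfl⟩)
  have hδ := delta_insert_le_of_R hwn (hmg a) (hmg b) (rot (rot hw))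
  have hall := hprim (insert w ((Finset.univ : Finset D).map g.toEmb.emb))
    (fun d => Finset.mem_insert_of_mem (hmg d)) ⟨w, Finset.mem_insert_self _ _, hwg⟩
    ((isStrong_coe_iff _).2 fun X hX =>
      hδ.trans (g.delta_map_le ((Finset.subset_insert _ _).trans hX)))
  have hE : ∀ y, y ∈ Set.range g.toFun ∨ y = w := by
    intro y
    rcases Finset.mem_insert.1 (hall y) with h | h
    · exact Or.inr h
    · obtain ⟨d, -, rfl⟩ := Finset.mem_map.1 h
      exact Or.inl ⟨d, rfl⟩
  obtain ⟨k, hk, -⟩ := Emb.exists_extend_point f.toEmb g.toEmb hE hwg hzf (by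
    intro c d
    rw [R_iff_col hzn (hmf a) (hmf b) (rot (rot hz))
        (f.delta_map_le (Finset.subset_insert _ _)) (hmf c) (hmf d),
      R_iff_col hwn (hmg a) (hmg b) (rot (rot hw))
        (g.delta_map_le (Finset.subset_insert _ _)) (hmg c) (hmg d),
      f.toEmb.col_iff, f.toEmb.col_iff, g.toEmb.col_iff, g.toEmb.col_iff,
      f.inj.ne_iff, g.inj.ne_iff])
  refine ⟨⟨k, Emb.isStrong_of_extends f g.toEmb k hk ?_⟩, hk⟩
  rw [← Finset.eq_univ_iff_forall.2 hall, ← delta_map g.toEmb (Finset.univ : Finset D)]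
  exact hδ

/-- Amalgamation of a primitive extension: either it embeds into `F`, or the free amalgam belongs
to `K̂_μ`. -/
theorem PrimitiveEmb.exists_amalgam {μ : GoodPair → ℕ} (hμ : InU μ) [Fintype D] [Fintype E]
    {f : StrongEmb D F} {g : StrongEmb D E} (hprim : PrimitiveEmb g.toEmb)
    (hF : InKmuHat μ F) (hE : InKmuHat μ E) :
    (∃ k : StrongEmb E F, ∀ d, k.toFun (g.toFun d) = f.toFun d) ∨
      ∃ (G : Type u) (_ : CollSpace G) (i : StrongEmb F G) (j : StrongEmb E G),
        InKmuHat μ G ∧ ∀ d, i.toFun (f.toFun d) = j.toFun (g.toFun d) := by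
  by_cases hconf : ∃ a b z w, R (f.toFun a) (f.toFun b) z ∧ z ∉ Set.range f.toFun ∧
      R (g.toFun a) (g.toFun b) w ∧ w ∉ Set.range g.toFun
  · obtain ⟨a, b, z, w, hz, hzf, hw, hwg⟩ := hconf
    exact Or.inl (hprim.exists_strongEmb_of_conflict hz hzf hw hwg)
  obtain ⟨G, _, i, j, hcomm, hij, hcover, hfree⟩ := exists_glue f.toEmb g.toEmb (by
    intro a b z y hz hy
    by_contra! hcon
    exact hconf ⟨a, b, z, y, hz, hcon.1, hy, hcon.2⟩) (Fintype.equivFin E)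
  have hrj : ((Finset.univ.map j.emb : Finset G) : Set G) = Set.range j.toFun := by
    ext
    simp
  have hmem : ∀ x, x ∈ (Finset.univ.map j.emb : Finset G) ↔ x ∈ Set.range j.toFun := by simp
  have hmemD : ∀ x, x ∈ (Finset.univ.map (j.comp g.toEmb).emb : Finset G) ↔
      ∃ d, j.toFun (g.toFun d) = x := by simp [Emb.comp]
  have hfa : FreeAmalgam (Set.range i.toFun) (Finset.univ.map j.emb)
      (Finset.univ.map (j.comp g.toEmb).emb) := by
    refine ⟨fun x => ?_, fun x => ?_, fun x y z h => ?_, fun X hDX hXE => ?_,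
      fun X hDX hXF => ?_⟩
    · rw [hmem, hmemD]
      constructor
      · rintro ⟨d, rfl⟩
        exact ⟨⟨_, rfl⟩, f.toFun d, (hcomm d).symm⟩
      · rintro ⟨⟨y, rfl⟩, z, h⟩
        obtain ⟨d, rfl, -⟩ := hij y z h.symm
        exact ⟨d, rfl⟩
    · rw [hmem]
      exact hcover x
    · simp only [hmem]
      exact hfree x y z h
    · obtain ⟨X', rfl⟩ := j.exists_map_eq (A := X) (fun x hx => (hmem x).1 (hXE hx))
      rw [delta_map, delta_map]
      refine g.delta_le fun y hy => ?_
      obtain ⟨d, -, rfl⟩ := Finset.mem_map.1 hy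
      exact (Finset.mem_map' j.emb).1 (hDX ((hmemD _).2 ⟨d, rfl⟩))
    · obtain ⟨X', rfl⟩ := i.exists_map_eq (A := X) hXF
      rw [delta_map, delta_map]
      refine f.delta_le fun y hy => ?_
      obtain ⟨d, -, rfl⟩ := Finset.mem_map.1 hy
      exact (Finset.mem_map' i.emb).1 (hDX ((hmemD _).2 ⟨d, hcomm d⟩))
  have hprim' : ∀ X, Finset.univ.map (j.comp g.toEmb).emb ⊂ X →
      X ⊆ Finset.univ.map j.emb → Le X (Finset.univ.map j.emb) → X = Finset.univ.map j.emb := by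
    intro X hDX hXE hle
    obtain ⟨X', rfl⟩ := j.exists_map_eq (A := X) (fun x hx => (hmem x).1 (hXE hx))
    refine congrArg _ (Finset.eq_univ_iff_forall.2 (hprim X' (fun d => ?_) ?_ ?_))
    · exact (Finset.mem_map' j.emb).1 (hDX.1 ((hmemD _).2 ⟨d, rfl⟩))
    · obtain ⟨x, hx, hxn⟩ := Finset.exists_of_ssubset hDX
      obtain ⟨y, hy, rfl⟩ := Finset.mem_map.1 hx
      refine ⟨y, hy, ?_⟩
      rintro ⟨d, rfl⟩
      exact hxn ((hmemD _).2 ⟨d, rfl⟩)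
    · rw [isStrong_coe_iff]
      intro Y hY
      have := hle.2 (Y.map j.emb) (Finset.map_subset_map.2 hY)
        (Finset.map_subset_map.2 (Finset.subset_univ _))
      rwa [delta_map, delta_map] at this
  rcases hfa.boundedIn_or_exists_copy hμ hprim' (hF.boundedIn_range i)
    (by rw [hrj]; exact hE.boundedIn_range j) with hb | ⟨hδ, k, hkD, hkF, hki, hkR⟩
  · refine Or.inr ⟨G, inferInstance, ⟨i, hfa.strong_right⟩, ⟨j, hrj ▸ hfa.strong_left⟩,
      hb.mono (Set.subset_univ _) |>.inKmuHat (StrongEmb.refl G).toEmb, fun d => (hcomm d).symm⟩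
  · left
    have hjE : ∀ y, j.toFun y ∈ (Finset.univ.map j.emb : Finset G) := fun y => (hmem _).2 ⟨y, rfl⟩
    choose k' hk' using fun y => hkF _ (hjE y)
    have hk'g : ∀ d, k' (g.toFun d) = f.toFun d := by
      intro d
      apply i.inj
      rw [hk', hkD _ ((hmemD _).2 ⟨d, rfl⟩), hcomm]
    let k₀ : Emb E F := ⟨k', fun x y e => j.inj (hki (hjE x) (hjE y) (by rw [← hk', ← hk', e])),
      fun x y z => by
        rw [← i.map_R, hk', hk', hk', hkR _ (hjE x) _ (hjE y) _ (hjE z), j.map_R]⟩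
    refine ⟨⟨k₀, Emb.isStrong_of_extends f g.toEmb k₀ hk'g ?_⟩, hk'g⟩
    rw [delta_map, delta_map] at hδ
    exact hδ.le

/-! ### The dimension function -/

theorem dimM_le (hF : InKHat0 F) {X Y : Finset F} (h : X ⊆ Y) : dimM X ≤ delta Y :=
  csInf_le ⟨0, by rintro _ ⟨Z, -, rfl⟩; exact hF Z⟩ ⟨Y, h, rfl⟩

theorem le_dimM {X : Finset F} {n : ℤ} (h : ∀ Y, X ⊆ Y → n ≤ delta Y) : n ≤ dimM X :=
  le_csInf ⟨_, X, subset_rfl, rfl⟩ (by rintro _ ⟨Z, hZ, rfl⟩; exact h Z hZ)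

/-- If every point of `F` lies in a superset of `S` of predimension at most `δ(S)`, so does
every finite subset. -/
theorem exists_superset_of_forall_point {S : Finset F} (hS : ∀ Y, S ⊆ Y → delta S ≤ delta Y)
    (h : ∀ z, ∃ Y, S ⊆ Y ∧ z ∈ Y ∧ delta Y ≤ delta S) (X : Finset F) :
    ∃ Y, S ⊆ Y ∧ X ⊆ Y ∧ delta Y ≤ delta S := by
  induction X using Finset.induction_on with
  | empty => exact ⟨S, subset_rfl, by simp, le_rfl⟩
  | insert x X _ ih =>
    obtain ⟨Y, hSY, hXY, hY⟩ := ih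
    obtain ⟨Z, hSZ, hxZ, hZ⟩ := h x
    refine ⟨Y ∪ Z, hSY.trans Finset.subset_union_left, Finset.insert_subset
      (Finset.mem_union_right _ hxZ) (hXY.trans Finset.subset_union_left), ?_⟩
    have := delta_submodular Y Z
    have := hS _ (Finset.subset_inter hSY hSZ)
    linarith

/-- A primitive extension embeds into a member of `K^μ_d` of sufficient dimension. -/
theorem PrimitiveEmb.exists_strongEmb_of_inKmud {μ : GoodPair → ℕ} (hμ : InU μ) [Fintype D]
    [Fintype E] {f : StrongEmb D F} {g : StrongEmb D E} (hprim : PrimitiveEmb g.toEmb)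
    (hF : InKmud μ F) (hE : InKmuHat μ E) {X : Finset F}
    (hX : delta (Finset.univ : Finset E) ≤ dimM X) :
    ∃ k : StrongEmb E F, ∀ d, k.toFun (g.toFun d) = f.toFun d := by
  have hmf : ∀ d, f.toFun d ∈ (Finset.univ : Finset D).map f.toEmb.emb :=
    fun d => Finset.mem_map_of_mem f.toEmb.emb (Finset.mem_univ d)
  have hmg : ∀ d, g.toFun d ∈ (Finset.univ : Finset D).map g.toEmb.emb :=
    fun d => Finset.mem_map_of_mem g.toEmb.emb (Finset.mem_univ d)
  by_cases hδ : delta (Finset.univ : Finset E) ≤ delta (Finset.univ : Finset D)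
  · rcases hprim.exists_amalgam (f := f) hμ hF.1 hE with h | ⟨G, _, i, j, hG, hcomm⟩
    · exact h
    -- `F` is `d`-closed in the amalgam `G`, which is algebraic over `F`
    have hcl := hF.2 G hG i
    have hlift : ∀ y, j.toFun y ∈ Set.range i.toFun := by
      intro y
      set D' : Finset G := Finset.univ.map (i.comp f).toEmb.emb with hD'
      have hD'j : D' ⊆ Finset.univ.map j.toEmb.emb := by
        intro x hx
        obtain ⟨d, -, rfl⟩ := Finset.mem_map.1 hx
        rw [Emb.emb_apply, StrongEmb.comp_apply, hcomm]
        exact Finset.mem_map_of_mem j.toEmb.emb (Finset.mem_univ _)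
      refine hcl _ D' (fun x hx => ?_) (le_antisymm ?_ ?_)
      · obtain ⟨d, -, rfl⟩ := Finset.mem_map.1 (Finset.mem_coe.1 hx)
        exact ⟨f.toFun d, rfl⟩
      · refine (dimM_le hG.inKHat0 (Y := Finset.univ.map j.toEmb.emb)
          (Finset.insert_subset (Finset.mem_map_of_mem j.toEmb.emb (Finset.mem_univ y))
            hD'j)).trans (le_dimM fun Y hY => ?_)
        rw [delta_map]
        exact hδ.trans ((i.comp f).delta_le hY)
      · exact le_dimM fun Y hY => dimM_le hG.inKHat0 ((Finset.subset_insert _ _).trans hY)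
    obtain ⟨k, hk⟩ := StrongEmb.exists_lift i.toEmb j hlift
    exact ⟨k, fun d => i.inj (by rw [hk, hcomm])⟩
  · push Not at hδ
    have hbig : ∀ Y : Finset E, (∀ d, g.toFun d ∈ Y) → (∃ y ∈ Y, y ∉ Set.range g.toFun) →
        delta (Finset.univ : Finset D) + 1 ≤ delta Y := by
      intro Y hgY hY
      by_contra! hlt
      have hall := hprim Y hgY hY ((isStrong_coe_iff _).2 fun Z hZ => by
        have := g.delta_le (X := Z) (fun x hx => by
          obtain ⟨d, -, rfl⟩ := Finset.mem_map.1 hx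
          exact hZ (hgY d))
        linarith)
      rw [Finset.eq_univ_iff_forall.2 hall] at hlt
      linarith
    obtain ⟨w, hwg⟩ : ∃ w, w ∉ Set.range g.toFun := by
      by_contra! hall
      have : (Finset.univ : Finset D).map g.toEmb.emb = Finset.univ := by
        refine Finset.eq_univ_iff_forall.2 fun y => ?_
        obtain ⟨d, rfl⟩ := hall y
        exact hmg d
      rw [← this, delta_map] at hδ
      exact lt_irrefl _ hδ
    have hwn : w ∉ (Finset.univ : Finset D).map g.toEmb.emb := fun h => hwg (by
      obtain ⟨d, -, rfl⟩ := Finset.mem_map.1 h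
      exact ⟨d, rfl⟩)
    have hins := delta_insert_le w _ hwn
    rw [delta_map] at hins
    have hall := hprim (insert w ((Finset.univ : Finset D).map g.toEmb.emb))
      (fun d => Finset.mem_insert_of_mem (hmg d)) ⟨w, Finset.mem_insert_self _ _, hwg⟩
      ((isStrong_coe_iff _).2 fun Y hY => hins.trans (hbig Y
        (fun d => hY (Finset.mem_insert_of_mem (hmg d)))
        ⟨w, hY (Finset.mem_insert_self _ _), hwg⟩))
    have hEins := Finset.eq_univ_iff_forall.2 hall
    rw [hEins] at hins
    have hE' : ∀ y, y ∈ Set.range g.toFun ∨ y = w := by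
      intro y
      rcases Finset.mem_insert.1 (hall y) with h | h
      · exact Or.inr h
      · obtain ⟨d, -, rfl⟩ := Finset.mem_map.1 h
        exact Or.inl ⟨d, rfl⟩
    -- a point of `F` independent of the image of `D`
    obtain ⟨z, hz⟩ : ∃ z : F, ∀ Y, Finset.univ.map f.toEmb.emb ⊆ Y → z ∈ Y →
        delta (Finset.univ : Finset D) < delta Y := by
      by_contra! hcon
      obtain ⟨Y, hSY, hXY, hY⟩ := exists_superset_of_forall_point
        (S := Finset.univ.map f.toEmb.emb) (fun Y hY => f.delta_map_le hY) (fun z => by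
          obtain ⟨Y, h1, h2, h3⟩ := hcon z
          exact ⟨Y, h1, h2, by rwa [delta_map]⟩) X
      have := dimM_le hF.1.inKHat0 hXY
      rw [delta_map] at hY
      linarith
    have hzn : z ∉ (Finset.univ : Finset D).map f.toEmb.emb := fun h => by
      have := hz _ subset_rfl h
      rw [delta_map] at this
      exact lt_irrefl _ this
    obtain ⟨k, hk, hkw⟩ := Emb.exists_extend_point f.toEmb g.toEmb (z := z) hE' hwg
      (by
        rintro ⟨d, rfl⟩
        exact hzn (hmf d))
      (fun a b => iff_of_false
        (fun hR => by
          have h1 := delta_insert_le_of_R hzn (hmf a) (hmf b) hR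
          have h2 := hz _ (Finset.subset_insert _ _) (Finset.mem_insert_self _ _)
          rw [delta_map] at h1
          linarith)
        (fun hR => by
          have h1 := delta_insert_le_of_R hwn (hmg a) (hmg b) hR
          rw [delta_map, hEins] at h1
          linarith))
    refine ⟨⟨k, k.isStrong_of_delta_le fun Y hY => ?_⟩, hk⟩
    have := hz Y (fun x hx => by
      obtain ⟨d, -, rfl⟩ := Finset.mem_map.1 hx
      rw [Emb.emb_apply, ← hk]
      exact hY (Finset.mem_map_of_mem k.emb (Finset.mem_univ _)))
      (hkw ▸ hY (Finset.mem_map_of_mem k.emb (Finset.mem_univ _)))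
    linarith

end Gluing

end CollSpace

namespace CollSpace

section Amalgamation

open Classical

/-! ### Amalgamation of finite extensions -/

/-- Every proper strong subset extends to a strong subset by a primitive extension. -/
theorem exists_primitive_step {E : Type v} [CollSpace E] [Fintype E] {A : Finset E}
    (hA : IsStrong (A : Set E)) (hne : A ≠ Finset.univ) :
    ∃ (E₁ : Finset E) (g : StrongEmb A E₁), A ⊂ E₁ ∧ IsStrong (E₁ : Set E) ∧
      (∀ x, (g.toFun x).1 = x.1) ∧ PrimitiveEmb g.toEmb := by
  obtain ⟨E₁, hE₁, hmin⟩ := Finset.exists_min_image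
    (Finset.univ.filter fun S : Finset E => A ⊂ S ∧ IsStrong (S : Set E)) Finset.card
    ⟨Finset.univ, by
      simp only [Finset.mem_filter, Finset.mem_univ, true_and, Finset.coe_univ]
      exact ⟨(Finset.subset_univ _).ssubset_of_ne hne, isStrong_univ⟩⟩
  simp only [Finset.mem_filter, Finset.mem_univ, true_and] at hE₁ hmin
  obtain ⟨g, hg⟩ := StrongEmb.exists_lift (Emb.incl (· ∈ E₁)) (StrongEmb.incl (p := (· ∈ A)) hA)
    (fun x => ⟨⟨x.1, hE₁.1.1 x.2⟩, rfl⟩)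
  refine ⟨E₁, g, hE₁.1, hE₁.2, hg, fun X hgX ⟨x, hx, hxg⟩ hX => ?_⟩
  have hXs : IsStrong ((X.map (Emb.incl (· ∈ E₁)).emb : Finset E) : Set E) := by
    have := hX.image (StrongEmb.incl (p := (· ∈ E₁)) hE₁.2)
    rw [Finset.coe_map]
    exact this
  have hAX : A ⊂ X.map (Emb.incl (· ∈ E₁)).emb := by
    refine ⟨fun a ha => ?_, fun hsub => ?_⟩
    · refine Finset.mem_map.2 ⟨_, hgX ⟨a, ha⟩, hg ⟨a, ha⟩⟩
    · have hxA := hsub (Finset.mem_map_of_mem (Emb.incl (· ∈ E₁)).emb hx)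
      exact hxg ⟨⟨_, hxA⟩, Subtype.ext (hg _)⟩
  have hcard := hmin _ ⟨hAX, hXs⟩
  rw [Finset.card_map] at hcard
  have : X = Finset.univ := by
    rw [← Finset.card_eq_iff_eq_univ]
    refine le_antisymm (Finset.card_le_univ _) ?_
    rwa [Fintype.card_coe]
  intro y
  rw [this]
  exact Finset.mem_univ y

/-- Downward induction over the strong subsets of a finite structure along primitive
extensions. -/
theorem primitive_induction {E : Type v} [CollSpace E] [Fintype E] (Q : Finset E → Prop)
    (huniv : Q Finset.univ)
    (hstep : ∀ (A E₁ : Finset E) (g : StrongEmb A E₁), IsStrong (E₁ : Set E) →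
      (∀ x, (g.toFun x).1 = x.1) → PrimitiveEmb g.toEmb → Q E₁ → Q A)
    (A : Finset E) (hA : IsStrong (A : Set E)) : Q A := by
  induction hn : Fintype.card E - A.card using Nat.strong_induction_on generalizing A with
  | _ n ih =>
    by_cases hne : A = Finset.univ
    · rwa [hne]
    obtain ⟨E₁, g, hss, hE₁, hg, hprim⟩ := exists_primitive_step hA hne
    refine hstep A E₁ g hE₁ hg hprim (ih _ ?_ E₁ hE₁ rfl)
    have := Finset.card_lt_card hss
    have := Finset.card_le_univ E₁
    omega

theorem exists_strongEmb_univ {E : Type v} [CollSpace E] [Fintype E] :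
    ∃ k : StrongEmb E (Finset.univ : Finset E), ∀ x : (Finset.univ : Finset E),
      k.toFun x.1 = x := by
  obtain ⟨k, -, hk⟩ := Emb.exists_inverse (Emb.incl (· ∈ (Finset.univ : Finset E)))
    (fun x => ⟨⟨x, Finset.mem_univ x⟩, rfl⟩)
  exact ⟨k, hk⟩

/-- The image of a strong embedding into a finite structure, as a strong subset. -/
theorem StrongEmb.exists_image {D : Type w} {E : Type v} [CollSpace D] [CollSpace E] [Fintype D]
    (g : StrongEmb D E) : ∃ (A : Finset E) (k : StrongEmb A D), IsStrong (A : Set E) ∧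
      (∀ x, g.toFun (k.toFun x) = x.1) ∧ ∀ d, ∃ x, k.toFun x = d := by
  have hA : IsStrong (((Finset.univ : Finset D).map g.toEmb.emb : Finset E) : Set E) := by
    have : (((Finset.univ : Finset D).map g.toEmb.emb : Finset E) : Set E) =
        Set.range g.toFun := by
      ext
      simp
    rw [this]
    exact g.strong
  obtain ⟨k, hk⟩ := StrongEmb.exists_lift g.toEmb (StrongEmb.incl (p := fun x =>
    x ∈ (Finset.univ : Finset D).map g.toEmb.emb) hA) (fun x => by
      obtain ⟨d, -, hd⟩ := Finset.mem_map.1 x.2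
      exact ⟨d, hd⟩)
  refine ⟨_, k, hA, hk, fun d => ⟨⟨g.toFun d, Finset.mem_map_of_mem g.toEmb.emb
    (Finset.mem_univ d)⟩, g.inj (hk _)⟩⟩

theorem exists_amalgam {μ : GoodPair → ℕ} (hμ : InU μ) {D : Type w} {E : Type v} {F : Type u}
    [CollSpace D] [CollSpace E] [Fintype E] [CollSpace F] (hF : InKmuHat μ F)
    (hE : InKmuHat μ E) (f : StrongEmb D F) (g : StrongEmb D E) :
    ∃ (G : Type u) (_ : CollSpace G) (f' : StrongEmb F G) (g' : StrongEmb E G),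
      InKmuHat μ G ∧ ∀ x, f'.toFun (f.toFun x) = g'.toFun (g.toFun x) := by
  let Q : Finset E → Prop := fun A => ∀ (F : Type u) [CollSpace F], InKmuHat μ F →
    ∀ f : StrongEmb A F, ∃ (G : Type u) (_ : CollSpace G) (f' : StrongEmb F G)
      (g' : StrongEmb E G), InKmuHat μ G ∧ ∀ x, f'.toFun (f.toFun x) = g'.toFun x.1
  have key : ∀ A : Finset E, IsStrong (A : Set E) → Q A := by
    refine primitive_induction Q ?_ ?_
    · intro F _ hF f
      obtain ⟨k, hk⟩ := exists_strongEmb_univ (E := E)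
      refine ⟨F, inferInstance, StrongEmb.refl F, f.comp k, hF, fun x => ?_⟩
      rw [StrongEmb.comp_apply, hk]
      rfl
    · intro A E₁ i _ hi hprim hQ F _ hF f
      rcases hprim.exists_amalgam (f := f) hμ hF (hE.of_emb (Emb.incl (· ∈ E₁))) with
        ⟨k, hk⟩ | ⟨G₁, _, f₁, g₁, hG₁, hcomm₁⟩
      · obtain ⟨G, _, f', g', hG, hcomm⟩ := hQ F hF k
        refine ⟨G, inferInstance, f', g', hG, fun x => ?_⟩
        rw [← hk, hcomm, hi]
      · obtain ⟨G, _, f', g', hG, hcomm⟩ := hQ G₁ hG₁ g₁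
        refine ⟨G, inferInstance, f'.comp f₁, g', hG, fun x => ?_⟩
        rw [StrongEmb.comp_apply, hcomm₁, hcomm, hi]
  have : Fintype D := Fintype.ofInjective _ g.inj
  obtain ⟨A, k, hA, hk, hsurj⟩ := g.exists_image
  obtain ⟨G, _, f', g', hG, hcomm⟩ := key A hA F hF (f.comp k)
  refine ⟨G, inferInstance, f', g', hG, fun d => ?_⟩
  obtain ⟨x, rfl⟩ := hsurj d
  rw [hk, ← hcomm, StrongEmb.comp_apply]

theorem exists_strongEmb_of_inKmud {μ : GoodPair → ℕ} (hμ : InU μ) {D : Type w} {E : Type v}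
    {F : Type u} [CollSpace D] [CollSpace E] [Fintype E] [CollSpace F] (hF : InKmud μ F)
    (hE : InKmuHat μ E) (f : StrongEmb D F) (g : StrongEmb D E) {X : Finset F}
    (hX : delta (Finset.univ : Finset E) ≤ dimM X) :
    ∃ h : StrongEmb E F, ∀ x, h.toFun (g.toFun x) = f.toFun x := by
  let Q : Finset E → Prop := fun A => ∀ f : StrongEmb A F,
    ∃ h : StrongEmb E F, ∀ x : A, h.toFun x.1 = f.toFun x
  have key : ∀ A : Finset E, IsStrong (A : Set E) → Q A := by
    refine primitive_induction Q ?_ ?_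
    · intro f
      obtain ⟨k, hk⟩ := exists_strongEmb_univ (E := E)
      refine ⟨f.comp k, fun x => ?_⟩
      rw [StrongEmb.comp_apply, hk]
    · intro A E₁ i hE₁ hi hprim hQ f
      have hδ : delta (Finset.univ : Finset E₁) ≤ delta (Finset.univ : Finset E) :=
        (StrongEmb.incl (p := (· ∈ E₁)) hE₁).delta_le (Finset.subset_univ _)
      obtain ⟨k, hk⟩ := hprim.exists_strongEmb_of_inKmud (f := f) hμ hF
        (hE.of_emb (Emb.incl (· ∈ E₁))) (hδ.trans hX)
      obtain ⟨h, hh⟩ := hQ k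
      refine ⟨h, fun x => ?_⟩
      rw [← hk, ← hh, hi]
  have : Fintype D := Fintype.ofInjective _ g.inj
  obtain ⟨A, k, hA, hk, hsurj⟩ := g.exists_image
  obtain ⟨h, hh⟩ := key A hA (f.comp k)
  refine ⟨h, fun d => ?_⟩
  obtain ⟨x, rfl⟩ := hsurj d
  rw [hk, hh, StrongEmb.comp_apply]

/-- Amalgamation within the finite members of `K̂_μ`: the union of the two images suffices. -/
theorem exists_finite_amalgam {μ : GoodPair → ℕ} (hμ : InU μ) {D : Type w} {E : Type v}
    {F : Type u} [CollSpace D] [CollSpace E] [Finite E] [CollSpace F] [Finite F]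
    (hF : InKmuHat μ F) (hE : InKmuHat μ E) (f : StrongEmb D F) (g : StrongEmb D E) :
    ∃ (G : Type u) (_ : CollSpace G) (f' : StrongEmb F G) (g' : StrongEmb E G),
      InKmu μ G ∧ ∀ x, f'.toFun (f.toFun x) = g'.toFun (g.toFun x) := by
  have := Fintype.ofFinite E
  have := Fintype.ofFinite F
  obtain ⟨G, _, f', g', hG, hcomm⟩ := exists_amalgam hμ hF hE f g
  set S : Finset G := Finset.univ.map f'.toEmb.emb ∪ Finset.univ.map g'.toEmb.emb with hS
  obtain ⟨f₁, hf₁⟩ := StrongEmb.exists_lift (Emb.incl (· ∈ S)) f' (fun x => ⟨⟨f'.toFun x,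
    Finset.mem_union_left _ (Finset.mem_map_of_mem f'.toEmb.emb (Finset.mem_univ x))⟩, rfl⟩)
  obtain ⟨g₁, hg₁⟩ := StrongEmb.exists_lift (Emb.incl (· ∈ S)) g' (fun x => ⟨⟨g'.toFun x,
    Finset.mem_union_right _ (Finset.mem_map_of_mem g'.toEmb.emb (Finset.mem_univ x))⟩, rfl⟩)
  refine ⟨S, inferInstance, f₁, g₁, hG S, fun x => (Emb.incl (· ∈ S)).inj ?_⟩
  rw [hf₁, hg₁, hcomm]

/-! ### Limits of chains -/

/-- The direct limit of a sequence of injections: germs of points that are eventually identified. -/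
theorem exists_set_limit (X : ℕ → Type u) (s : ∀ n, X n → X (n + 1))
    (hs : ∀ n, Function.Injective (s n)) :
    ∃ (M : Type u) (ι : ∀ n, X n → M), (∀ n, Function.Injective (ι n)) ∧
      (∀ n x, ι (n + 1) (s n x) = ι n x) ∧ ∀ x, ∃ n y, ι n y = x := by
  let push : ∀ {n m : ℕ}, n ≤ m → X n → X m := fun h x => Nat.leRecOn h (fun {k} => s k) x
  have hpush : ∀ {n m k : ℕ} (h : n ≤ m) (h' : m ≤ k) (x : X n),
      push (h.trans h') x = push h' (push h x) := fun h h' x => Nat.leRecOn_trans h h' x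
  have hinj : ∀ {n m : ℕ} (h : n ≤ m), Function.Injective (push h) := fun h =>
    Nat.leRecOn_injective h _ hs
  let S : Setoid (Σ n, X n) :=
    { r := fun a b => ∃ k, ∃ (h : a.1 ≤ k) (h' : b.1 ≤ k), push h a.2 = push h' b.2
      iseqv :=
        { refl := fun a => ⟨a.1, le_rfl, le_rfl, rfl⟩
          symm := fun ⟨k, h, h', e⟩ => ⟨k, h', h, e.symm⟩
          trans := by
            rintro a b c ⟨k, h₁, h₂, e⟩ ⟨k', h₃, h₄, e'⟩
            refine ⟨max k k', h₁.trans (le_max_left _ _), h₄.trans (le_max_right _ _), ?_⟩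
            rw [hpush h₁ (le_max_left k k'), e, ← hpush, hpush h₄ (le_max_right k k'), ← e',
              ← hpush] } }
  refine ⟨Quotient S, fun n x => Quotient.mk S ⟨n, x⟩, fun n x y h => ?_, fun n x => ?_,
    fun x => ?_⟩
  · obtain ⟨k, h₁, h₂, e⟩ := Quotient.exact h
    exact hinj h₁ e
  · refine Quotient.sound ⟨n + 1, le_rfl, n.le_succ, ?_⟩
    exact (Nat.leRecOn_self (C := X) _).trans (Nat.leRecOn_succ' (C := X) _).symm
  · obtain ⟨⟨n, y⟩, rfl⟩ := Quotient.exists_rep x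
    exact ⟨n, y, rfl⟩

/-- The union of a chain of strong embeddings. -/
theorem exists_limit (X : ℕ → Type u) [∀ n, CollSpace (X n)]
    (s : ∀ n, StrongEmb (X n) (X (n + 1))) :
    ∃ (M : Type u) (_ : CollSpace M) (ι : ∀ n, StrongEmb (X n) M),
      (∀ n x, (ι (n + 1)).toFun ((s n).toFun x) = (ι n).toFun x) ∧
      (∀ x, ∃ n, x ∈ Set.range (ι n).toFun) ∧
      ∀ (A : Finset M) (n : ℕ), ∃ m, n ≤ m ∧ (A : Set M) ⊆ Set.range (ι m).toFun := by
  obtain ⟨M, ι, hinj, hcomm, hsurj⟩ := exists_set_limit X (fun n => (s n).toFun)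
    (fun n => (s n).inj)
  have hlift : ∀ n m, n ≤ m → ∃ e : StrongEmb (X n) (X m), ∀ x, ι m (e.toFun x) = ι n x := by
    intro n m h
    induction m, h using Nat.le_induction with
    | base => exact ⟨StrongEmb.refl _, fun x => rfl⟩
    | succ m _ ih =>
      obtain ⟨e, he⟩ := ih
      exact ⟨(s m).comp e, fun x => by rw [StrongEmb.comp_apply, hcomm, he]⟩
  let inst : CollSpace M :=
    { R := fun x y z => ∃ n a b c, ι n a = x ∧ ι n b = y ∧ ι n c = z ∧ R a b c
      ne₁₂ := by
        rintro _ _ _ ⟨n, a, b, c, rfl, rfl, rfl, h⟩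
        exact (hinj n).ne (ne₁₂ h)
      ne₁₃ := by
        rintro _ _ _ ⟨n, a, b, c, rfl, rfl, rfl, h⟩
        exact (hinj n).ne (ne₁₃ h)
      ne₂₃ := by
        rintro _ _ _ ⟨n, a, b, c, rfl, rfl, rfl, h⟩
        exact (hinj n).ne (ne₂₃ h)
      swap := by
        rintro _ _ _ ⟨n, a, b, c, rfl, rfl, rfl, h⟩
        exact ⟨n, b, a, c, rfl, rfl, rfl, swap h⟩
      rot := by
        rintro _ _ _ ⟨n, a, b, c, rfl, rfl, rfl, h⟩
        exact ⟨n, b, c, a, rfl, rfl, rfl, rot h⟩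
      line := by
        rintro _ _ _ _ ⟨n, a, b, c, rfl, rfl, rfl, h⟩ ⟨m, a', b', d, ha, hb, rfl, h'⟩ hne
        obtain ⟨e, he⟩ := hlift n (max n m) (le_max_left _ _)
        obtain ⟨e', he'⟩ := hlift m (max n m) (le_max_right _ _)
        have h₁ : e'.toFun a' = e.toFun a := hinj _ (by rw [he, he', ha])
        have h₂ : e'.toFun b' = e.toFun b := hinj _ (by rw [he, he', hb])
        rw [← e.map_R] at h
        rw [← e'.map_R, h₁, h₂] at h'
        exact ⟨max n m, e.toFun a, e'.toFun d, e.toFun c, he _, he' _, he _,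
          line h h' fun e₀ => hne (by rw [← he, ← he', e₀])⟩ }
  let ιE : ∀ n, Emb (X n) M := fun n => ⟨ι n, hinj n, fun a b c => by
    constructor
    · rintro ⟨m, a', b', c', ha, hb, hc, h⟩
      obtain ⟨e, he⟩ := hlift n (max n m) (le_max_left _ _)
      obtain ⟨e', he'⟩ := hlift m (max n m) (le_max_right _ _)
      have h₁ : e'.toFun a' = e.toFun a := hinj _ (by rw [he, he', ha])
      have h₂ : e'.toFun b' = e.toFun b := hinj _ (by rw [he, he', hb])
      have h₃ : e'.toFun c' = e.toFun c := hinj _ (by rw [he, he', hc])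
      rwa [← e'.map_R, h₁, h₂, h₃, e.map_R] at h
    · exact fun h => ⟨n, a, b, c, rfl, rfl, rfl, h⟩⟩
  have hfin : ∀ (A : Finset M) (n : ℕ), ∃ m, n ≤ m ∧ (A : Set M) ⊆ Set.range (ι m) := by
    intro A n
    induction A using Finset.induction_on with
    | empty => exact ⟨n, le_rfl, by simp⟩
    | insert a A _ ih =>
      obtain ⟨m, hm, hA⟩ := ih
      obtain ⟨k, y, rfl⟩ := hsurj a
      obtain ⟨e, he⟩ := hlift m (max m k) (le_max_left _ _)
      obtain ⟨e', he'⟩ := hlift k (max m k) (le_max_right _ _)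
      refine ⟨max m k, hm.trans (le_max_left _ _), ?_⟩
      intro x hx
      rcases Finset.mem_insert.1 (Finset.mem_coe.1 hx) with rfl | hx
      · exact ⟨_, he' y⟩
      · obtain ⟨z, rfl⟩ := hA hx
        exact ⟨_, he z⟩
  have hstrong : ∀ n, IsStrong (Set.range (ι n)) := by
    intro n
    rw [isStrong_iff]
    intro A
    obtain ⟨m, hm, hA⟩ := hfin A n
    obtain ⟨e, he⟩ := hlift n m hm
    obtain ⟨A', rfl⟩ := (ιE m).exists_map_eq hA
    have := isStrong_iff.1 e.strong A'
    rw [delta_map]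
    refine le_trans (le_of_eq ?_) this
    rw [← delta_map (ιE m)]
    congr 1
    ext x
    simp only [Finset.mem_filter, Finset.mem_map, Set.mem_range]
    constructor
    · rintro ⟨⟨y, hy, rfl⟩, z, hz⟩
      exact ⟨y, ⟨hy, z, hinj m ((he z).trans hz)⟩, rfl⟩
    · rintro ⟨y, ⟨hy, z, rfl⟩, rfl⟩
      exact ⟨⟨_, hy, rfl⟩, z, (he z).symm⟩
  refine ⟨M, inst, fun n => ⟨ιE n, hstrong n⟩, hcomm, fun x => ?_, hfin⟩
  obtain ⟨n, y, h⟩ := hsurj x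
  exact ⟨n, y, h⟩

/-! ### The generic structure -/

/-- The structure carried along an injection. -/
@[reducible]
def comap {α : Type u} {M : Type v} [CollSpace M] (i : α → M) (hi : Function.Injective i) :
    CollSpace α where
  R x y z := R (i x) (i y) (i z)
  ne₁₂ h e := ne₁₂ h (congrArg i e)
  ne₁₃ h e := ne₁₃ h (congrArg i e)
  ne₂₃ h e := ne₂₃ h (congrArg i e)
  swap h := swap h
  rot h := rot h
  line h h' n := line h h' (hi.ne n)

theorem finite_collSpace (α : Type u) [Finite α] : Finite (CollSpace α) := by
  refine Finite.of_injective (fun c : CollSpace α => c.R) fun c c' h => ?_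
  cases c
  cases c'
  congr

theorem finite_strongEmb (M : Type u) (N : Type v) [CollSpace M] [CollSpace N] [Finite M]
    [Finite N] : Finite (StrongEmb M N) := by
  refine Finite.of_injective (fun f : StrongEmb M N => f.toFun) fun f f' h => ?_
  obtain ⟨⟨_, _, _⟩, _⟩ := f
  obtain ⟨⟨_, _, _⟩, _⟩ := f'
  congr

/-- An extension problem over `M`: a strong finite subset of `M` and a strong embedding of it
into a member of `K_μ` on `{0, …, m - 1}`, for some `m ≤ n`. -/
abbrev Problem (μ : GoodPair → ℕ) (M : Type u) [CollSpace M] (n : ℕ) : Type u :=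
  Σ (A : {A : Finset M // IsStrong (A : Set M)}) (m : Fin (n + 1))
    (c : {c : CollSpace (Fin m) // @InKmuHat μ (Fin m) c}),
    @StrongEmb A.1 (Fin m) _ c.1

/-- A solution of an extension problem over `M` in a strong extension of `M`. -/
def Solves {μ : GoodPair → ℕ} {M : Type u} {N : Type v} [CollSpace M] [CollSpace N] {n : ℕ}
    (s : StrongEmb M N) (t : Problem μ M n) : Prop :=
  ∃ h : @StrongEmb (Fin t.2.1) N t.2.2.1.1 _, ∀ x : t.1.1,
    (@Emb.toFun _ _ t.2.2.1.1 _ (@StrongEmb.toEmb _ _ t.2.2.1.1 _ h))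
      ((@Emb.toFun _ _ _ t.2.2.1.1 (@StrongEmb.toEmb _ _ _ t.2.2.1.1 t.2.2.2)) x) = s.toFun x.1

theorem exists_solve {μ : GoodPair → ℕ} (hμ : InU μ) {M : Type u} [CollSpace M] [Finite M]
    (hM : InKmuHat μ M) (n : ℕ) :
    ∃ (N : Type u) (_ : CollSpace N) (_ : Finite N) (s : StrongEmb M N), InKmuHat μ N ∧
      ∀ t : Problem μ M n, Solves s t := by
  have hfin : Finite (Problem μ M n) := by
    have := fun m : ℕ => finite_collSpace (Fin m)
    have : ∀ (A : {A : Finset M // IsStrong (A : Set M)}) (m : Fin (n + 1))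
      (c : {c : CollSpace (Fin m) // @InKmuHat μ (Fin m) c}),
      Finite (@StrongEmb A.1 (Fin m) _ c.1) := fun A m c => @finite_strongEmb _ _ _ c.1 _ _
    infer_instance
  have := Fintype.ofFinite (Problem μ M n)
  suffices h : ∀ T : Finset (Problem μ M n), ∃ (N : Type u) (_ : CollSpace N) (_ : Finite N)
      (s : StrongEmb M N), InKmuHat μ N ∧ ∀ t ∈ T, Solves s t by
    obtain ⟨N, i, hN, s, hK, hs⟩ := h Finset.univ
    exact ⟨N, i, hN, s, hK, fun t => hs t (Finset.mem_univ t)⟩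
  intro T
  induction T using Finset.induction_on with
  | empty => exact ⟨M, inferInstance, inferInstance, StrongEmb.refl M, hM, by simp⟩
  | insert t T _ ih =>
    obtain ⟨N, _, _, s, hN, hs⟩ := ih
    obtain ⟨A, m, c, g⟩ := t
    let _ : CollSpace (Fin m) := c.1
    obtain ⟨N', _, s', g', hN', hcomm⟩ := exists_finite_amalgam hμ hN c.2
      (s.comp (StrongEmb.incl (p := (· ∈ A.1)) A.2)) g
    refine ⟨N', inferInstance, hN'.1.1, s'.comp s, hN'.inKmuHat, fun t ht => ?_⟩
    rcases Finset.mem_insert.1 ht with rfl | ht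
    · exact ⟨g', fun x => (hcomm x).symm⟩
    · obtain ⟨h, hh⟩ := hs t ht
      let _ : CollSpace (Fin t.2.1) := t.2.2.1.1
      exact ⟨s'.comp h, fun x => congrArg s'.toFun (hh x)⟩

/-- A finite member of `K̂_μ`, equivalently a member of `K_μ`. -/
structure FiniteMember (μ : GoodPair → ℕ) where
  carrier : Type u
  [space : CollSpace carrier]
  [finite : Finite carrier]
  mem : InKmuHat μ carrier

attribute [instance] FiniteMember.space FiniteMember.finite

/-- The empty structure. -/
@[reducible]
def emptySpace : CollSpace PEmpty.{u + 1} where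
  R _ _ _ := False
  ne₁₂ := False.elim
  ne₁₃ := False.elim
  ne₂₃ := False.elim
  swap := False.elim
  rot := False.elim
  line h := h.elim

theorem nonempty_finiteMember (μ : GoodPair → ℕ) : Nonempty (FiniteMember.{u} μ) := by
  let _ : CollSpace PEmpty.{u + 1} := emptySpace
  have h : InKmu μ PEmpty.{u + 1} := by
    refine ⟨⟨inferInstance, fun A => ?_⟩, fun P e => chi_le_iff.2 fun 𝒞 hC _ => ?_⟩
    · rw [Finset.eq_empty_of_isEmpty A, delta_empty]
    · have : 𝒞 = ∅ := Finset.eq_empty_of_forall_notMem fun X hX => by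
        obtain ⟨x, -⟩ := (hC X hX).isGood.nonempty
        exact x.elim
      rw [this]
      exact Nat.zero_le _
  exact ⟨⟨PEmpty, h.inKmuHat⟩⟩

/-- The union of a chain of finite members of `K̂_μ`, in which the `n`-th step solves the extension
problems of size at most `n` over the `n`-th member, is generic. -/
theorem exists_generic {μ : GoodPair → ℕ} (hμ : InU μ) :
    ∃ (M : Type u) (_ : CollSpace M), IsGeneric μ M := by
  have hnext : ∀ (n : ℕ) (X : FiniteMember.{u} μ), ∃ (Y : FiniteMember.{u} μ)
      (s : StrongEmb X.carrier Y.carrier), ∀ t : Problem μ X.carrier n, Solves s t := by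
    intro n X
    obtain ⟨N, _, _, s, hN, hs⟩ := exists_solve hμ X.mem n
    exact ⟨⟨N, hN⟩, s, hs⟩
  choose next s hs using hnext
  obtain ⟨X₀⟩ := nonempty_finiteMember.{u} μ
  let X : ℕ → FiniteMember.{u} μ := fun n =>
    Nat.rec (motive := fun _ => FiniteMember.{u} μ) X₀ next n
  obtain ⟨M, _, ι, hι, hsurj, hfin⟩ := exists_limit (fun n => (X n).carrier) (fun n => s n (X n))
  refine ⟨M, inferInstance, ?_, ?_, ?_, ?_⟩
  · refine Function.Surjective.countable (f := fun p : Σ n, (X n).carrier => (ι p.1).toFun p.2) ?_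
    intro x
    obtain ⟨n, y, h⟩ := hsurj x
    exact ⟨⟨n, y⟩, h⟩
  · intro A
    obtain ⟨m, -, hA⟩ := hfin A 0
    obtain ⟨k, -⟩ := (ι m).toEmb.exists_lift (Emb.incl (· ∈ A)) (fun x => hA x.2)
    exact ((X m).mem.of_emb k).inKmu
  · intro A B _ _ hA hB f g
    have := hA.1.1
    have := hB.1.1
    have := Fintype.ofFinite A
    have := Fintype.ofFinite B
    obtain ⟨n, hn, hfn⟩ := hfin (Finset.univ.map f.toEmb.emb) (Fintype.card B)
    obtain ⟨f₁, hf₁⟩ := StrongEmb.exists_lift (ι n).toEmb f (fun x =>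
      hfn (Finset.mem_coe.2 (Finset.mem_map_of_mem f.toEmb.emb (Finset.mem_univ x))))
    obtain ⟨A', k, hA', hk, hksurj⟩ := f₁.exists_image
    -- a copy of `B` on `{0, …, m - 1}`
    let c : CollSpace (Fin (Fintype.card B)) :=
      comap (Fintype.equivFin B).symm (Fintype.equivFin B).symm.injective
    let β : Emb (Fin (Fintype.card B)) B :=
      ⟨(Fintype.equivFin B).symm, (Fintype.equivFin B).symm.injective, fun _ _ _ => Iff.rfl⟩
    obtain ⟨β', -⟩ := β.exists_inverse (Fintype.equivFin B).symm.surjective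
    have hc : InKmuHat μ (Fin (Fintype.card B)) := hB.inKmuHat.of_emb β
    obtain ⟨h, hh⟩ := hs n (X n) ⟨⟨A', hA'⟩, ⟨Fintype.card B, by omega⟩, ⟨c, hc⟩,
      (β'.comp g).comp k⟩
    refine ⟨((ι (n + 1)).comp h).comp β', fun a => ?_⟩
    obtain ⟨x, rfl⟩ := hksurj a
    have h₁ : (ι (n + 1)).toFun _ = (ι (n + 1)).toFun _ := congrArg (ι (n + 1)).toFun (hh x)
    refine h₁.trans ?_
    rw [hι, ← hf₁, hk]
  · intro A
    obtain ⟨m, -, hA⟩ := hfin A 0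
    have := Fintype.ofFinite (X m).carrier
    have hr : ((Finset.univ.map (ι m).toEmb.emb : Finset M) : Set M) =
        Set.range (ι m).toFun := by
      ext
      simp
    refine ⟨Finset.univ.map (ι m).toEmb.emb, ?_, ?_⟩
    · rw [← Finset.coe_subset, hr]
      exact hA
    · rw [hr]
      exact (ι m).strong

end Amalgamation

end CollSpace

theorem mainTheorem6 (μ : CollSpace.GoodPair → ℕ) (hμ : CollSpace.InU μ) :
    -- amalgamation of `F ∈ K̂_μ` and `E ∈ K_μ` over a common strong substructure `D`
    (∀ (D : Type w) (E : Type v) (F : Type u)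
        [CollSpace D] [CollSpace E] [Fintype E] [CollSpace F],
        CollSpace.InKmuHat μ F → CollSpace.InKmu μ E →
        ∀ (f : CollSpace.StrongEmb D F) (g : CollSpace.StrongEmb D E),
          (∃ (G : Type u) (_ : CollSpace G)
              (f' : CollSpace.StrongEmb F G) (g' : CollSpace.StrongEmb E G),
              CollSpace.InKmuHat μ G ∧
                ∀ x, f'.toFun (f.toFun x) = g'.toFun (g.toFun x)) ∧
          -- if `F ∈ K^μ_d` has dimension at least `δ(E)`, then `G` can be taken to be `F`
          (CollSpace.InKmud μ F →
            (∃ X : Finset F,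
              CollSpace.delta (Finset.univ : Finset E) ≤ CollSpace.dimM X) →
            ∃ h : CollSpace.StrongEmb E F, ∀ x, h.toFun (g.toFun x) = f.toFun x)) ∧
    -- the amalgamation property, and existence of a generic structure
    CollSpace.AmalgamationProperty.{u} μ ∧
    ∃ (M : Type u) (_ : CollSpace M), CollSpace.IsGeneric μ M := by
  refine ⟨fun D E F _ _ _ _ hF hE f g => ⟨CollSpace.exists_amalgam hμ hF hE.inKmuHat f g,
    fun hFd ⟨X, hX⟩ => CollSpace.exists_strongEmb_of_inKmud hμ hFd hE.inKmuHat f g hX⟩,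
    fun D E F _ _ _ _ hE hF f g => ?_, CollSpace.exists_generic hμ⟩
  have := hE.1.1
  have := hF.1.1
  exact CollSpace.exists_finite_amalgam hμ hF.inKmuHat hE.inKmuHat f g
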